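/- **Setting.** Claims arrive at rate $\lambda>0$. With probability $\varepsilon\in(0,1)$ a claim is heavy-tailed, with law $B_h$ on $[0,\infty)$; with probability $1-\varepsilon$ it is light-tailed, with phase-type law $B_p$. Both laws have finite mean. Let $B=(1-\varepsilon)B_p+\varepsilon B_h$ be the claim size law, $\gamma_h=\lambda\int x\,B_h(dx)$ and $\rho=\lambda\int x\,B(dx)$, and assume $\rho<1$. For a law $G$ on $[0,\infty)$ with mean $m_G\in(0,\infty)$, its stationary excess law has distribution function $u\mapsto\int_0^u G((x,\infty))\,dx/m_G$. Let $F_e$ and $F_e^h$ be the excess laws of $B$ and $B_h$, let $\overline F_e^h(u)=1-F_e^h(u)$, and assume that $F_e^h$ is subexponential. Let $N$ be geometric, $\mathbb P(N=k)=(1-\rho)\rho^k$ for $k=0,1,2,\dots$, independent of i.i.d. variables $C_1,C_2,\dots$ with law $F_e$. For $n\ge 1$ and $u\ge 0$ put $$V=\sum_{k=1}^{N+2}C_k,\qquad \tilde V_n=\max\{C_1,\dots,C_{N+2}\}\,\mathbf 1_{\{N+2\le n\}},\qquad Z=\rho^2\mathbf 1_{\{V>u\}},\qquad \tilde Z_n=\rho^2\mathbf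 1_{\{\tilde V_n>u\}} .$$ From $R\ge 2$ independent copies $(Z^{(i)},\tilde Z_n^{(i)})$ of $(Z,\tilde Z_n)$ form the crude PK estimator $\bar Z=\frac1R\sum_i Z^{(i)}$ and the PK control-variate estimator $$\hat z_{n,R}(u)=\bar Z+\hat a\,\bigl(\bar{\tilde Z}_n-\mathbb E\tilde Z_n\bigr),\qquad \bar{\tilde Z}_n=\frac1R\sum_i\tilde Z_n^{(i)},\qquad \hat a=-\frac{\sum_i (Z^{(i)}-\bar Z)(\tilde Z_n^{(i)}-\bar{\tilde Z}_n)}{\sum_i(\tilde Z_n^{(i)}-\bar{\tilde Z}_n)^2},$$ with $\hat a:=0$ when the denominator vanishes. **Theorem.** For each fixed $n\ge1$ and each fixed $R\ge2$, as $u\to\infty$, $$\operatorname{Var}\bigl(\hat z_{n,R}(u)\bigr)\sim\rho^{n+3}\,\frac{1+n(1-\rho)}{1-\rho}\cdot\frac{\varepsilon\gamma_h}{\rho}\cdot\frac{\overline F_e^h(u)}{R}$$ and $$\frac{\operatorname{Var}(\hat z_{n,R}(u))}{\operatorname{Var}(\bar Z)}\longrightarrow\rho^{n-1}\,\frac{1+n(1-\rho)}{1+(1-\rho)}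 .$$ -/

import Mathlib

open MeasureTheory ProbabilityTheory Filter Topology Asymptotics Set
open scoped NNReal ENNReal Matrix

noncomputable section

/-! ### Phase-type distributions -/

/-- The intensity matrix `Λ = [[T, t], [0, 0]]`, with exit rates `t = -T e`, on the `p` states
`some i` together with the absorbing state `none`. -/
def phaseGenerator {p : ℕ} (T : Matrix (Fin p) (Fin p) ℝ) :
    Matrix (Option (Fin p)) (Option (Fin p)) ℝ :=
  Matrix.of fun a b =>
    match a, b with
    | none, _ => 0
    | some i, some j => T i j
    | some i, none => -∑ j, T i j

/-- `T` is a sub-intensity matrix all of whose states are transient: as `none` is the only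
absorbing state of a finite chain, transience of all states `some i` means that `none` can be
reached from each of them. -/
structure IsTransientSubIntensity {p : ℕ} (T : Matrix (Fin p) (Fin p) ℝ) : Prop where
  off_diag_nonneg : ∀ i j, i ≠ j → 0 ≤ T i j
  row_sum_nonpos : ∀ i, ∑ j, T i j ≤ 0
  transient : ∀ i, ∃ t : ℝ, 0 ≤ t ∧ 0 < NormedSpace.exp (t • phaseGenerator T) (some i) none

/-- `X` is a time-homogeneous Markov jump process on a finite state space with right-continuous
paths, initial distribution `init` and intensity matrix `Λ`, that is, with transition matrices
`exp (t Λ)`. -/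
structure IsMarkovJumpProcess {E Ω : Type*} [Fintype E] [DecidableEq E] [MeasurableSpace Ω]
    (Λ : Matrix E E ℝ) (init : E → ℝ) (P : Measure Ω) (X : ℝ≥0 → Ω → E) : Prop where
  measurable : ∀ t s, MeasurableSet {ω | X t ω = s}
  right_cont : ∀ ω t, ∀ᶠ r in 𝓝[>] t, X r ω = X t ω
  fin_dim : ∀ (m : ℕ) (t : Fin (m + 1) → ℝ≥0) (s : Fin (m + 1) → E), t 0 = 0 → Monotone t →
    P.real {ω | ∀ k, X (t k) ω = s k} =
      init (s 0) * ∏ k : Fin m,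
        NormedSpace.exp (((t k.succ : ℝ) - (t k.castSucc : ℝ)) • Λ) (s k.castSucc) (s k.succ)

/-- The absorption time `inf {t > 0 | X_t = none}`. -/
def absorptionTime {p : ℕ} {Ω : Type*} (X : ℝ≥0 → Ω → Option (Fin p)) (ω : Ω) : ℝ :=
  sInf {t : ℝ | ∃ r : ℝ≥0, 0 < r ∧ t = r ∧ X r ω = none}

/-- `μ` is a phase-type distribution: the law of the time to absorption of a finite Markov jump
process with `p` transient states and one absorbing state, started in the transient states. -/
def IsPhaseType (μ : Measure ℝ) : Prop :=
  ∃ (p : ℕ) (π : Fin p → ℝ) (T : Matrix (Fin p) (Fin p) ℝ),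
    (∀ i, 0 ≤ π i) ∧ ∑ i, π i = 1 ∧ IsTransientSubIntensity T ∧
    ∃ (Ω : Type) (_ : MeasurableSpace Ω) (P : Measure Ω) (_ : IsProbabilityMeasure P)
      (X : ℝ≥0 → Ω → Option (Fin p)),
      IsMarkovJumpProcess (phaseGenerator T) (fun s => s.elim 0 π) P X ∧
      HasLaw (absorptionTime X) μ P

/-! ### Subexponential distributions -/

/-- `F` is a subexponential distribution on `[0, ∞)`: its tail is everywhere positive, and for
every `n ≥ 1` the tail of its `n`-fold convolution is asymptotic to `n` times its tail. -/
structure IsSubexponential (F : Measure ℝ) : Prop where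
  isProbabilityMeasure : IsProbabilityMeasure F
  nonneg : F (Iio 0) = 0
  tail_pos : ∀ u, 0 < F.real (Ioi u)
  conv_tail : ∀ n : ℕ, 1 ≤ n →
    (fun u : ℝ => (Measure.pi fun _ : Fin n => F).real {x | u < ∑ i, x i})
      ~[atTop] fun u : ℝ => (n : ℝ) * F.real (Ioi u)

/-! ### The claim sizes -/

/-- The mean of a law on `ℝ`. -/
def lawMean (μ : Measure ℝ) : ℝ := ∫ x, x ∂μ

/-- The claim size law: with probability `ε` a heavy-tailed claim, with probability `1 - ε` a
phase-type claim. -/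
def mixtureLaw (ε : ℝ) (light heavy : Measure ℝ) : Measure ℝ :=
  ENNReal.ofReal (1 - ε) • light + ENNReal.ofReal ε • heavy

/-- The stationary excess law of `μ`: its density is `(1 - F(x)) / mean` on `(0, ∞)`, where `F` is
the distribution function of `μ`. -/
def excessLaw (μ : Measure ℝ) : Measure ℝ :=
  (volume.restrict (Ioi 0)).withDensity fun x => ENNReal.ofReal (μ.real (Ioi x) / lawMean μ)

/-! ### Control variates for the Pollaczek–Khinchine series -/

/-- The law of one simulated copy `(N, (C₁, C₂, …))` of the ingredients of the
Pollaczek–Khinchine series: `N` is geometric, `ℙ(N = k) = (1 - ρ) ρ ^ k` for `k = 0, 1, …`, and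
independent of the `C_k`, which are i.i.d. with law `F`. The claim `C_k` is stored at index
`k - 1`. The projection onto the unit interval only serves typing: it is the identity for
`0 ≤ ρ ≤ 1`. -/
def pkLaw (ρ : ℝ) (F : Measure ℝ) : Measure (ℕ × (ℕ → ℝ)) :=
  (geometricMeasure (projIcc (0 : ℝ) 1 zero_le_one (1 - ρ))).prod
    (Measure.infinitePi fun _ : ℕ => F)

/-- `V = C₁ + ⋯ + C_{N+2}`. -/
def pkSum (x : ℕ × (ℕ → ℝ)) : ℝ := ∑ k ∈ Finset.range (x.1 + 2), x.2 k

/-- `Ṽₙ = max {C₁, …, C_{N+2}} · 1{N + 2 ≤ n}`. -/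
def pkTruncMax (n : ℕ) (x : ℕ × (ℕ → ℝ)) : ℝ :=
  if x.1 + 2 ≤ n then
    (Finset.range (x.1 + 2)).sup' (Finset.nonempty_range_iff.mpr (Nat.succ_ne_zero _)) x.2
  else 0

/-- The crude Monte Carlo variable `Z = ρ² 1{V > u}`. -/
def pkCrude (ρ u : ℝ) (x : ℕ × (ℕ → ℝ)) : ℝ := if u < pkSum x then ρ ^ 2 else 0

/-- The control variate `Z̃ₙ = ρ² 1{Ṽₙ > u}`. -/
def pkControl (ρ : ℝ) (n : ℕ) (u : ℝ) (x : ℕ × (ℕ → ℝ)) : ℝ :=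
  if u < pkTruncMax n x then ρ ^ 2 else 0

/-- The empirical mean of `R` numbers. -/
def empMean {R : ℕ} (z : Fin R → ℝ) : ℝ := (∑ i, z i) / R

/-- The empirical coefficient
`- ∑ (zᵢ - mean z) (wᵢ - mean w) / ∑ (wᵢ - mean w)²`. If all `wᵢ` agree, this `0 / 0` is `0`,
that is, no control is applied. -/
def empCoeff {R : ℕ} (z w : Fin R → ℝ) : ℝ :=
  -((∑ i, (z i - empMean z) * (w i - empMean w)) / ∑ i, (w i - empMean w) ^ 2)

/-- The control variate estimator computed from the pairs `(zᵢ, wᵢ)`, where `m` is the known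
expectation of the control variate. -/
def controlVariateEstimator {R : ℕ} (z w : Fin R → ℝ) (m : ℝ) : ℝ :=
  empMean z + empCoeff z w * (empMean w - m)

/-- The crude estimator: the empirical mean of `Z` over the `R` simulated copies `x`. -/
def pkCrudeEstimator {R : ℕ} (ρ u : ℝ) (x : Fin R → ℕ × (ℕ → ℝ)) : ℝ :=
  empMean fun i => pkCrude ρ u (x i)

/-- The control variate estimator of order `n` from the `R` simulated copies `x`, where the
expectation of the control variate is taken under the law of a copy. -/
def pkControlEstimator {R : ℕ} (ρ : ℝ) (F : Measure ℝ) (n : ℕ) (u : ℝ)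
    (x : Fin R → ℕ × (ℕ → ℝ)) : ℝ :=
  controlVariateEstimator (fun i => pkCrude ρ u (x i)) (fun i => pkControl ρ n u (x i))
    (∫ y, pkControl ρ n u y ∂(pkLaw ρ F))

end

/-! ### Tails of convolutions -/

/-! Write `p = ℙ(V > u)`, `q = ℙ(Ṽₙ > u)`, `s = ρ²`. Call a copy with `Z ≠ 0` a hit; almost surely a
copy with `Z̃ₙ ≠ 0` is a hit. For fixed `R` only samples with exactly one hit matter to first order.
Without a hit the estimator is `0`. With one hit where the control is `0`, the coefficient is `0 / 0
= 0` and the estimator is `s / R`. With one hit shared by the control, the two samples coincide, the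
coefficient is `-1`, and the estimator is the constant `𝔼 Z̃ₙ = O(p)`. Two or more hits have
probability `O(p²)`, and the coefficient is bounded because there are finitely many samples. Hence
the second moment is `(s² / R) (p - q) + O(p²)`, the squared mean is `O(p²)`, and the variance is
`ρ⁴ / R * (p - q) + O(p²)`: see `controlVariateEstimator_bounds` and
`abs_variance_pkControlEstimator_sub_le`. To estimate `p - q`, condition on `N`. For a
subexponential law the sum and the maximum of `k` claims both have tail `~ k F̄ₑ(u)`, so the terms
with `N + 2 ≤ n` cancel and the others leave `𝔼[(N + 2) 1{N + 2 > n}] F̄ₑ(u)`. Kesten's bound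
dominates the series (`IsSubexpTwoFold.tendsto_pkLaw_diff`). In particular `p² = o(F̄ₑ(u))`.
Finally, phase-type tails decay exponentially, so `F̄ₑ(u) ~ (ε γ_h / ρ) F̄ₑʰ(u)`, and
subexponentiality passes from `Fₑʰ` to `Fₑ` by tail equivalence. The crude estimator is the case `n
= 1`. -/

theorem conv_real_Ioi (μ ν : Measure ℝ) (u : ℝ) :
    (μ ∗ ν).real (Ioi u) = (μ.prod ν).real {x : ℝ × ℝ | u < x.1 + x.2} := by
  rw [Measure.conv, map_measureReal_apply (by fun_prop) measurableSet_Ioi]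
  rfl

theorem ae_nonneg_of_measure_Iio {μ : Measure ℝ} (h : μ (Iio 0) = 0) : ∀ᵐ x ∂μ, 0 ≤ x := by
  rw [ae_iff]
  simpa [Iio] using h

theorem prod_ae_nonneg {μ ν : Measure ℝ} [SFinite μ] [SFinite ν] (hμ : μ (Iio 0) = 0)
    (hν : ν (Iio 0) = 0) : ∀ᵐ x ∂(μ.prod ν), 0 ≤ x.1 ∧ 0 ≤ x.2 := by
  have h1 := Measure.quasiMeasurePreserving_fst (μ := μ) (ν := ν) |>.ae
    (ae_nonneg_of_measure_Iio hμ)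
  have h2 := Measure.quasiMeasurePreserving_snd (μ := μ) (ν := ν) |>.ae
    (ae_nonneg_of_measure_Iio hν)
  filter_upwards [h1, h2] with x a b using ⟨a, b⟩

theorem conv_nonneg {μ ν : Measure ℝ} [SFinite μ] [SFinite ν] (hμ : μ (Iio 0) = 0)
    (hν : ν (Iio 0) = 0) : (μ ∗ ν) (Iio 0) = 0 := by
  rw [Measure.conv, Measure.map_apply (by fun_prop) measurableSet_Iio]
  refine measure_mono_null ?_ (ae_iff.1 (prod_ae_nonneg hμ hν))
  intro x hx h
  simp only [mem_preimage, mem_Iio] at hx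
  linarith [h.1, h.2]

theorem measureReal_Iic_eq (μ : Measure ℝ) [IsProbabilityMeasure μ] (u : ℝ) :
    μ.real (Iic u) = 1 - μ.real (Ioi u) := by
  rw [← compl_Ioi, probReal_compl_eq_one_sub measurableSet_Ioi]

theorem antitone_measureReal_Ioi (μ : Measure ℝ) [IsFiniteMeasure μ] :
    Antitone fun u => μ.real (Ioi u) :=
  fun _ _ h => measureReal_mono (Ioi_subset_Ioi h)

theorem tendsto_measureReal_Ioi (μ : Measure ℝ) [IsProbabilityMeasure μ] :
    Tendsto (fun u => μ.real (Ioi u)) atTop (𝓝 0) := by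
  have h := (tendsto_cdf_atTop μ).const_sub 1
  simp only [cdf_eq_real, sub_self] at h
  refine h.congr fun u => ?_
  rw [measureReal_Iic_eq]; ring

/-- A sum of nonnegative variables is at most `u` only if both summands are. -/
theorem conv_tail_ge {μ ν : Measure ℝ} [IsProbabilityMeasure μ] [IsProbabilityMeasure ν]
    (hμ : μ (Iio 0) = 0) (hν : ν (Iio 0) = 0) (u : ℝ) :
    μ.real (Ioi u) + ν.real (Ioi u) - μ.real (Ioi u) * ν.real (Ioi u)
      ≤ (μ ∗ ν).real (Ioi u) := by
  have h : (μ ∗ ν).real (Iic u) ≤ μ.real (Iic u) * ν.real (Iic u) := by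
    rw [Measure.conv, map_measureReal_apply (by fun_prop) measurableSet_Iic,
      ← measureReal_prod_prod]
    refine ENNReal.toReal_mono (measure_ne_top _ _) (measure_mono_ae ?_)
    filter_upwards [prod_ae_nonneg hμ hν] with x hx h
    change x.1 + x.2 ≤ u at h
    exact ⟨mem_Iic.2 (by linarith), mem_Iic.2 (by linarith)⟩
  simp only [measureReal_Iic_eq] at h
  linarith

/-- Comparison of product measures through the sections of a set. -/
theorem prod_real_le_of_sections {μ ν F : Measure ℝ} [IsFiniteMeasure μ] [IsFiniteMeasure ν]
    [IsFiniteMeasure F] {K : ℝ} (hK : 0 ≤ K) {S : Set (ℝ × ℝ)} (hS : MeasurableSet S)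
    (h : ∀ y, μ.real ((fun x => (x, y)) ⁻¹' S) ≤ K * ν.real ((fun x => (x, y)) ⁻¹' S)) :
    (μ.prod F).real S ≤ K * (ν.prod F).real S := by
  have key : (μ.prod F) S ≤ ENNReal.ofReal K * (ν.prod F) S := by
    rw [Measure.prod_apply_symm hS, Measure.prod_apply_symm hS,
      ← lintegral_const_mul' _ _ ENNReal.ofReal_ne_top]
    refine lintegral_mono fun y => ?_
    have := ENNReal.ofReal_le_ofReal (h y)
    rwa [ENNReal.ofReal_mul hK, ofReal_measureReal, ofReal_measureReal] at this
  have := ENNReal.toReal_mono (by finiteness) key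
  rwa [ENNReal.toReal_mul, ENNReal.toReal_ofReal hK] at this

/-- Split according to whether the second summand `y` exceeds `u - a`. If not, the first must exceed
`u - y ≥ a`, where `μ` may be replaced by `F` at cost `K`; under `F ⊗ F` this event is disjoint from
`{y > u}`, which accounts for the subtracted term. This is the induction step both for Kesten's
bound and for the limits of convolution powers. -/
theorem conv_tail_le {μ F : Measure ℝ} [IsProbabilityMeasure μ] [IsProbabilityMeasure F]
    (hF : F (Iio 0) = 0) {a K : ℝ} (ha : 0 ≤ a) (hK : 0 ≤ K)
    (h : ∀ t, a ≤ t → μ.real (Ioi t) ≤ K * F.real (Ioi t)) (u : ℝ) :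
    (μ ∗ F).real (Ioi u) ≤
      F.real (Ioi (u - a)) + K * ((F ∗ F).real (Ioi u) - F.real (Ioi u)) := by
  set S : Set (ℝ × ℝ) := {x | x.2 ≤ u - a ∧ u < x.1 + x.2}
  have hS : MeasurableSet S :=
    (measurableSet_le measurable_snd measurable_const).inter
      (measurableSet_lt measurable_const (measurable_fst.add measurable_snd))
  have h1 : (μ.prod F).real S ≤ K * (F.prod F).real S := by
    refine prod_real_le_of_sections hK hS fun y => ?_
    by_cases hy : y ≤ u - a
    · have : (fun x : ℝ => (x, y)) ⁻¹' S = Ioi (u - y) := by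
        ext x
        simp only [S, mem_preimage, mem_ofPred_eq, hy, true_and, mem_Ioi]
        exact sub_lt_iff_lt_add.symm
      rw [this]
      exact h _ (by linarith)
    · have : (fun x : ℝ => (x, y)) ⁻¹' S = ∅ := by
        ext x
        simp [S, hy]
      simp [this]
  have h2 : (F.prod F).real S + F.real (Ioi u) ≤ (F ∗ F).real (Ioi u) := by
    have hU : F.real (Ioi u) = (F.prod F).real (univ ×ˢ Ioi u) := by
      rw [measureReal_prod_prod]; simp
    rw [hU, ← measureReal_union _ (MeasurableSet.univ.prod measurableSet_Ioi), conv_real_Ioi]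
    · refine ENNReal.toReal_mono (measure_ne_top _ _) (measure_mono_ae ?_)
      filter_upwards [prod_ae_nonneg hF hF] with x hx hh
      rcases hh with hh | hh
      · exact hh.2
      · have : u < x.2 := hh.2
        change u < x.1 + x.2
        linarith
    · rw [disjoint_left]
      rintro x hx hx'
      have h1 : u < x.2 := hx'.2
      have h2 : x.2 ≤ u - a := hx.1
      linarith
  have h3 : (μ ∗ F).real (Ioi u) ≤ F.real (Ioi (u - a)) + (μ.prod F).real S := by
    have hU : F.real (Ioi (u - a)) = (μ.prod F).real (univ ×ˢ Ioi (u - a)) := by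
      rw [measureReal_prod_prod]; simp
    rw [hU, conv_real_Ioi]
    refine (measureReal_mono ?_).trans (measureReal_union_le _ _)
    intro x hx
    by_cases hy : x.2 ≤ u - a
    · exact Or.inr ⟨hy, hx⟩
    · exact Or.inl ⟨mem_univ _, not_le.1 hy⟩
  have := mul_le_mul_of_nonneg_left h2 hK
  linarith

/-! ### Subexponential laws through their two-fold convolution -/

/-- A law on `[0, ∞)` with positive tail `F̄`, such that the tail of the two-fold convolution is
asymptotic to `2 F̄`. -/
structure IsSubexpTwoFold (F : Measure ℝ) : Prop where
  isProbabilityMeasure : IsProbabilityMeasure F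
  nonneg : F (Iio 0) = 0
  tail_pos : ∀ u, 0 < F.real (Ioi u)
  two_fold : Tendsto (fun u => (F ∗ F).real (Ioi u) / F.real (Ioi u)) atTop (𝓝 2)

theorem IsSubexponential.isSubexpTwoFold {F : Measure ℝ} (h : IsSubexponential F) :
    IsSubexpTwoFold F := by
  have := h.isProbabilityMeasure
  refine ⟨this, h.nonneg, h.tail_pos, ?_⟩
  have h2 := h.conv_tail 2 (by norm_num)
  rw [isEquivalent_iff_tendsto_one
    (Eventually.of_forall fun u => mul_ne_zero (by norm_num) (h.tail_pos u).ne')] at h2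
  have h3 := h2.const_mul 2
  rw [mul_one] at h3
  refine h3.congr fun u => ?_
  have : (Measure.pi fun _ : Fin 2 => F).real {x | u < ∑ i, x i} = (F ∗ F).real (Ioi u) := by
    have hS : MeasurableSet {x : ℝ × ℝ | u < x.1 + x.2} :=
      measurableSet_lt measurable_const (measurable_fst.add measurable_snd)
    rw [conv_real_Ioi, ← (measurePreserving_finTwoArrow F).measureReal_preimage
      hS.nullMeasurableSet]
    congr 1
    ext x
    simp [Fin.sum_univ_two]
  simp only [Pi.div_apply, this]
  have := (h.tail_pos u).ne'
  field_simp
  push_cast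
  ring

theorem IsSubexpTwoFold.long_tailed {F : Measure ℝ} (h : IsSubexpTwoFold F) {a : ℝ}
    (ha : 0 ≤ a) : Tendsto (fun u => F.real (Ioi (u - a)) / F.real (Ioi u)) atTop (𝓝 1) := by
  have := h.isProbabilityMeasure
  have hT := tendsto_measureReal_Ioi F
  have hlim : Tendsto (fun u => ((F ∗ F).real (Ioi u) / F.real (Ioi u) - 1 - F.real (Iic a)) /
      (F.real (Ioi a) - F.real (Ioi u))) atTop (𝓝 1) := by
    have h1 : Tendsto (fun u => ((F ∗ F).real (Ioi u) / F.real (Ioi u) - 1 - F.real (Iic a)) /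
      (F.real (Ioi a) - F.real (Ioi u))) atTop
        (𝓝 ((2 - 1 - F.real (Iic a)) / (F.real (Ioi a) - 0))) :=
      ((h.two_fold.sub_const _).sub_const _).div (hT.const_sub _)
        (by simpa using (h.tail_pos a).ne')
    convert h1 using 2
    rw [measureReal_Iic_eq, sub_zero, eq_comm, div_eq_one_iff_eq (h.tail_pos a).ne']
    ring
  refine tendsto_of_tendsto_of_tendsto_of_le_of_le' tendsto_const_nhds hlim ?_ ?_
  · refine Eventually.of_forall fun u => ?_
    rw [le_div_iff₀ (h.tail_pos u), one_mul]
    exact antitone_measureReal_Ioi F (by linarith)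
  · filter_upwards [hT.eventually_lt_const (h.tail_pos a), eventually_ge_atTop a] with u hu hua
    have hFu := h.tail_pos u
    rw [le_div_iff₀ (by linarith), div_mul_eq_mul_div, div_le_iff₀ hFu, sub_mul, sub_mul,
      div_mul_cancel₀ _ hFu.ne']
    have e1 : F.real (Ioi u) = (F.prod F).real (Ioi u ×ˢ univ) := by
      rw [measureReal_prod_prod]; simp
    have e2 : F.real (Iic a) * F.real (Ioi u) = (F.prod F).real (Iic a ×ˢ Ioi u) := by
      rw [measureReal_prod_prod]
    have e3 : F.real (Ioi (u - a)) * (F.real (Ioi a) - F.real (Ioi u)) =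
        (F.prod F).real (Ioc a u ×ˢ Ioi (u - a)) := by
      rw [measureReal_prod_prod, ← Ioi_sdiff_Ioi,
        measureReal_sdiff (Ioi_subset_Ioi hua) measurableSet_Ioi, mul_comm]
    -- Three disjoint ways for the sum to exceed `u`, by the position of the first summand relative
    -- to `a` and `u`. Since the two-fold tail is `~ 2 F̄(u)`, the third leaves no room for `F̄(u -
    -- a)` to be asymptotically larger than `F̄(u)`.
    have key : (F.prod F).real (Ioi u ×ˢ univ) + (F.prod F).real (Iic a ×ˢ Ioi u) +
        (F.prod F).real (Ioc a u ×ˢ Ioi (u - a)) ≤ (F ∗ F).real (Ioi u) := by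
      rw [← measureReal_union _ (measurableSet_Iic.prod measurableSet_Ioi),
        ← measureReal_union _ (measurableSet_Ioc.prod measurableSet_Ioi), conv_real_Ioi]
      · refine ENNReal.toReal_mono (measure_ne_top _ _) (measure_mono_ae ?_)
        filter_upwards [prod_ae_nonneg h.nonneg h.nonneg] with x hx hh
        change u < x.1 + x.2
        rcases hh with (hh | hh) | hh
        · linarith [mem_Ioi.1 hh.1]
        · linarith [mem_Ioi.1 hh.2]
        · linarith [mem_Ioi.1 hh.2, hh.1.1]
      · rw [disjoint_left]
        rintro x (hx | hx) hx'
        · linarith [mem_Ioi.1 hx.1, hx'.1.2]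
        · linarith [mem_Iic.1 hx.1, hx'.1.1]
      · rw [disjoint_left]
        rintro x hx hx'
        linarith [mem_Ioi.1 hx.1, mem_Iic.1 hx'.1]
    linarith

/-- Long-tailed laws have heavier tails than every exponential law. -/
theorem IsSubexpTwoFold.exp_div_tail {F : Measure ℝ} (h : IsSubexpTwoFold F) {δ : ℝ}
    (hδ : 0 < δ) : Tendsto (fun u => Real.exp (-δ * u) / F.real (Ioi u)) atTop (𝓝 0) := by
  have := h.isProbabilityMeasure
  -- Eventually the tail loses at most a factor `exp (-δ / 2)` per unit step, hence stays above a
  -- multiple of `exp (-δ u / 2)`, which beats `exp (-δ u)`.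
  have h1 : 1 < Real.exp (δ / 2) := Real.one_lt_exp_iff.2 (by linarith)
  obtain ⟨b, hb⟩ := eventually_atTop.1 ((h.long_tailed zero_le_one).eventually_lt_const h1)
  have step : ∀ u, b ≤ u → Real.exp (-(δ / 2)) * F.real (Ioi (u - 1)) ≤ F.real (Ioi u) := by
    intro u hu
    have := (div_lt_iff₀ (h.tail_pos u)).1 (hb u hu)
    rw [Real.exp_neg, inv_mul_le_iff₀ (Real.exp_pos _)]
    exact this.le
  have iter : ∀ k : ℕ, Real.exp (-(δ / 2) * k) * F.real (Ioi b) ≤ F.real (Ioi (b + k)) := by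
    intro k
    induction k with
    | zero => simp
    | succ k ih =>
      have := step (b + (k + 1 : ℕ)) (by simp; positivity)
      rw [show b + ((k + 1 : ℕ) : ℝ) - 1 = b + k by push_cast; ring] at this
      refine le_trans ?_ this
      rw [show -(δ / 2) * ((k + 1 : ℕ) : ℝ) = -(δ / 2) + -(δ / 2) * k by push_cast; ring,
        Real.exp_add, mul_assoc]
      exact mul_le_mul_of_nonneg_left ih (Real.exp_pos _).le
  set c := Real.exp (-(δ / 2) * (1 - b)) * F.real (Ioi b)
  have hc : 0 < c := mul_pos (Real.exp_pos _) (h.tail_pos b)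
  have lower : ∀ u, b ≤ u → c * Real.exp (-(δ / 2) * u) ≤ F.real (Ioi u) := by
    intro u hu
    have hk := Nat.le_ceil (u - b)
    have hk' := Nat.ceil_lt_add_one (sub_nonneg.2 hu)
    refine le_trans ?_ ((iter ⌈u - b⌉₊).trans
      (antitone_measureReal_Ioi F (show u ≤ b + ⌈u - b⌉₊ by linarith)))
    rw [mul_right_comm, ← Real.exp_add]
    refine mul_le_mul_of_nonneg_right (Real.exp_le_exp.2 ?_) (h.tail_pos b).le
    nlinarith
  have lim : Tendsto (fun u => c⁻¹ * Real.exp (-(δ / 2) * u)) atTop (𝓝 0) := by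
    have : Tendsto (fun u : ℝ => -(δ / 2) * u) atTop atBot :=
      tendsto_id.const_mul_atTop_of_neg (by linarith)
    simpa using (Real.tendsto_exp_atBot.comp this).const_mul c⁻¹
  refine tendsto_of_tendsto_of_tendsto_of_le_of_le' tendsto_const_nhds lim
    (Eventually.of_forall fun u => by positivity) ?_
  filter_upwards [eventually_ge_atTop b] with u hu
  rw [div_le_iff₀ (h.tail_pos u)]
  calc Real.exp (-δ * u) = c⁻¹ * Real.exp (-(δ / 2) * u) * (c * Real.exp (-(δ / 2) * u)) := by
        rw [show -δ * u = -(δ / 2) * u + -(δ / 2) * u by ring, Real.exp_add]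
        field_simp
    _ ≤ _ := mul_le_mul_of_nonneg_left (lower u hu) (by positivity)

/-- Laws whose tail is asymptotic to a positive multiple of a subexponential tail are
subexponential. -/
theorem IsSubexpTwoFold.of_tail_equiv {H F : Measure ℝ} (h : IsSubexpTwoFold H)
    [IsProbabilityMeasure F] (hF : F (Iio 0) = 0) {c : ℝ} (hc : 0 < c)
    (hFH : Tendsto (fun u => F.real (Ioi u) / H.real (Ioi u)) atTop (𝓝 c)) :
    IsSubexpTwoFold F := by
  have := h.isProbabilityMeasure
  have hpos : ∀ u, 0 < F.real (Ioi u) := by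
    intro u
    obtain ⟨v, hv, huv⟩ := ((hFH.eventually_const_lt hc).and (eventually_ge_atTop u)).exists
    refine lt_of_lt_of_le ?_ (antitone_measureReal_Ioi F huv)
    rcases (div_pos_iff.1 hv) with h1 | h1
    · exact h1.1
    · exact absurd h1.2 (h.tail_pos v).not_gt
  have hHF : Tendsto (fun u => H.real (Ioi u) / F.real (Ioi u)) atTop (𝓝 c⁻¹) :=
    (hFH.inv₀ hc.ne').congr fun u => by rw [inv_div]
  have hlong : ∀ a, 0 ≤ a →
      Tendsto (fun u => F.real (Ioi (u - a)) / F.real (Ioi u)) atTop (𝓝 1) := by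
    intro a ha
    have h1 := ((hFH.comp (tendsto_atTop_add_const_right atTop (-a) tendsto_id)).mul
      (h.long_tailed ha)).mul hHF
    rw [mul_one, mul_inv_cancel₀ hc.ne'] at h1
    refine h1.congr fun u => ?_
    have e1 := (h.tail_pos (u - a)).ne'
    have e2 := (h.tail_pos u).ne'
    have e3 := (hpos u).ne'
    simp only [Function.comp_apply, id, ← sub_eq_add_neg]
    field_simp
  obtain ⟨b, hb⟩ := eventually_atTop.1
    (hFH.eventually_lt_const (show c < 2 * c by linarith))
  have hdom : ∀ t, b ≤ t → F.real (Ioi t) ≤ 2 * c * H.real (Ioi t) := fun t ht =>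
    ((div_lt_iff₀ (h.tail_pos t)).1 (hb t ht)).le
  -- Either one summand is at most `a` and the other exceeds `u - a`, or both exceed `a`. On the
  -- latter event `S`, `F` is replaced by `H` one coordinate at a time, at cost `2 c` each; the `H ⊗
  -- H` mass of `S` is what remains of `H ∗ H` once the events with one summand above `u` and the
  -- other at most `a` are removed.
  have upper : ∀ a, 0 ≤ a → b ≤ a → ∀ u, 2 * a < u → (F ∗ F).real (Ioi u) ≤
      2 * F.real (Ioi (u - a)) +
        2 * c * (2 * c * ((H ∗ H).real (Ioi u) - 2 * (H.real (Iic a) * H.real (Ioi u)))) := by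
    intro a ha hba u hu
    set S : Set (ℝ × ℝ) := {x | (a < x.1 ∧ a < x.2) ∧ u < x.1 + x.2}
    have hS : MeasurableSet S :=
      ((measurableSet_lt measurable_const measurable_fst).inter
        (measurableSet_lt measurable_const measurable_snd)).inter
      (measurableSet_lt measurable_const (measurable_fst.add measurable_snd))
    have hsec : ∀ y, F.real ((fun x => (x, y)) ⁻¹' S) ≤
        2 * c * H.real ((fun x => (x, y)) ⁻¹' S) := by
      intro y
      by_cases hy : a < y
      · have : (fun x : ℝ => (x, y)) ⁻¹' S = Ioi (max a (u - y)) := by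
          ext x
          simp only [S, mem_preimage, mem_ofPred_eq, hy, and_true, mem_Ioi, max_lt_iff,
            sub_lt_iff_lt_add]
        rw [this]
        exact hdom _ (hba.trans (le_max_left _ _))
      · have : (fun x : ℝ => (x, y)) ⁻¹' S = ∅ := by
          ext x
          simp [S, hy]
        simp [this]
    have hSswap : Prod.swap ⁻¹' S = S := by
      ext x
      simp only [S, mem_preimage, mem_ofPred_eq, Prod.fst_swap, Prod.snd_swap, add_comm x.2,
        and_comm (a := a < x.2)]
    have hswap : (H.prod F).real S = (F.prod H).real S := by
      rw [← (Measure.measurePreserving_swap (μ := H) (ν := F)).measureReal_preimage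
        hS.nullMeasurableSet, hSswap]
    have h1 : (F.prod F).real S ≤ 2 * c * (2 * c * (H.prod H).real S) := by
      refine (prod_real_le_of_sections (ν := H) (by positivity) hS hsec).trans ?_
      rw [hswap]
      exact mul_le_mul_of_nonneg_left
        (prod_real_le_of_sections (by positivity) hS hsec) (by positivity)
    have h2 : (H.prod H).real S + 2 * (H.real (Iic a) * H.real (Ioi u)) ≤
        (H ∗ H).real (Ioi u) := by
      have e1 : H.real (Iic a) * H.real (Ioi u) = (H.prod H).real (Iic a ×ˢ Ioi u) := by
        rw [measureReal_prod_prod]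
      have e2 : H.real (Iic a) * H.real (Ioi u) = (H.prod H).real (Ioi u ×ˢ Iic a) := by
        rw [measureReal_prod_prod, mul_comm]
      rw [two_mul]
      nth_rewrite 1 [e1]
      rw [e2, ← add_assoc, ← measureReal_union _ (measurableSet_Iic.prod measurableSet_Ioi),
        ← measureReal_union _ (measurableSet_Ioi.prod measurableSet_Iic), conv_real_Ioi]
      · refine ENNReal.toReal_mono (measure_ne_top _ _) (measure_mono_ae ?_)
        filter_upwards [prod_ae_nonneg h.nonneg h.nonneg] with x hx hh
        rcases hh with (hh | hh) | hh
        · exact hh.2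
        · change u < x.1 + x.2
          linarith [mem_Ioi.1 hh.2]
        · change u < x.1 + x.2
          linarith [mem_Ioi.1 hh.1]
      · rw [disjoint_left]
        rintro x (hx | hx) hx'
        · linarith [hx.1.2, mem_Iic.1 hx'.2]
        · linarith [mem_Iic.1 hx.1, mem_Ioi.1 hx'.1]
      · rw [disjoint_left]
        rintro x hx hx'
        linarith [hx.1.1, mem_Iic.1 hx'.1]
    have h3 : (F ∗ F).real (Ioi u) ≤ 2 * F.real (Ioi (u - a)) + (F.prod F).real S := by
      have e1 : F.real (Ioi (u - a)) = (F.prod F).real (univ ×ˢ Ioi (u - a)) := by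
        rw [measureReal_prod_prod]; simp
      have e2 : F.real (Ioi (u - a)) = (F.prod F).real (Ioi (u - a) ×ˢ univ) := by
        rw [measureReal_prod_prod]; simp
      rw [two_mul]
      nth_rewrite 1 [e1]
      rw [e2, conv_real_Ioi]
      refine (measureReal_mono ?_).trans ((measureReal_union_le _ S).trans
        (add_le_add_left (measureReal_union_le _ _) _))
      intro x hx
      change u < x.1 + x.2 at hx
      by_cases hx1 : a < x.1
      · by_cases hx2 : a < x.2
        · exact Or.inr ⟨⟨hx1, hx2⟩, hx⟩
        · exact Or.inl (Or.inr ⟨mem_Ioi.2 (by linarith), mem_univ _⟩)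
      · exact Or.inl (Or.inl ⟨mem_univ _, mem_Ioi.2 (by linarith)⟩)
    refine h3.trans (add_le_add_right (h1.trans ?_) _)
    have : (H.prod H).real S ≤
      (H ∗ H).real (Ioi u) - 2 * (H.real (Iic a) * H.real (Ioi u)) := by linarith
    gcongr
  refine ⟨inferInstance, hF, hpos, tendsto_order.2 ⟨fun d hd => ?_, fun d hd => ?_⟩⟩
  · have hl : Tendsto (fun u => 2 - F.real (Ioi u)) atTop (𝓝 2) := by
      simpa using (tendsto_measureReal_Ioi F).const_sub 2
    filter_upwards [hl.eventually_const_lt hd] with u hu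
    refine hu.trans_le ?_
    rw [le_div_iff₀ (hpos u)]
    have := conv_tail_ge hF hF u
    linarith
  -- As `u → ∞` the bound `upper`, divided by `F̄(u)`, tends to `2 + (2c)² (2 - 2 H(a)) / c = 2 + 8
  -- c H̄(a)`; then `a` is taken large.
  · have hsmall : Tendsto (fun a => 2 + 8 * c * H.real (Ioi a)) atTop (𝓝 2) := by
      simpa using ((tendsto_measureReal_Ioi H).const_mul (8 * c)).const_add 2
    obtain ⟨a, ⟨had, ha⟩, hba⟩ := (((hsmall.eventually_lt_const hd).and
      (eventually_ge_atTop 0)).and (eventually_ge_atTop b)).exists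
    have hl : Tendsto (fun u => 2 * (F.real (Ioi (u - a)) / F.real (Ioi u)) +
        2 * c * (2 * c * (((H ∗ H).real (Ioi u) / H.real (Ioi u) - 2 * H.real (Iic a)) *
          (H.real (Ioi u) / F.real (Ioi u))))) atTop (𝓝 (2 + 8 * c * H.real (Ioi a))) := by
      have h1 := ((hlong a ha).const_mul 2).add
        ((((h.two_fold.sub_const (2 * H.real (Iic a))).mul hHF).const_mul
          (2 * c)).const_mul (2 * c))
      convert h1 using 2
      rw [measureReal_Iic_eq]
      field_simp
      ring
    filter_upwards [hl.eventually_lt_const had, eventually_gt_atTop (2 * a)] with u hu hau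
    refine lt_of_le_of_lt ?_ hu
    rw [div_le_iff₀ (hpos u)]
    refine (upper a ha hba u hau).trans_eq ?_
    have e2 := (h.tail_pos u).ne'
    have e3 := (hpos u).ne'
    field_simp

/-! ### Convolution powers -/

/-- The `k`-fold convolution of `F` with itself. -/
noncomputable def convPow (F : Measure ℝ) : ℕ → Measure ℝ
  | 0 => Measure.dirac 0
  | k + 1 => convPow F k ∗ F

instance convPow.isProbabilityMeasure (F : Measure ℝ) [IsProbabilityMeasure F] (k : ℕ) :
    IsProbabilityMeasure (convPow F k) := by
  induction k with
  | zero => exact Measure.dirac.isProbabilityMeasure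
  | succ k ih => rw [convPow]; infer_instance

theorem convPow_nonneg {F : Measure ℝ} [IsProbabilityMeasure F] (hF : F (Iio 0) = 0) (k : ℕ) :
    convPow F k (Iio 0) = 0 := by
  induction k with
  | zero => simp [convPow]
  | succ k ih => exact conv_nonneg ih hF

theorem convPow_zero_tail {F : Measure ℝ} {u : ℝ} (hu : 0 ≤ u) :
    (convPow F 0).real (Ioi u) = 0 := by
  simp [convPow, measureReal_def, hu]

/-- Kesten's bound. -/
theorem IsSubexpTwoFold.convPow_tail_le {F : Measure ℝ} (h : IsSubexpTwoFold F) {r : ℝ}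
    (hr : 1 < r) : ∃ M, 0 ≤ M ∧ ∀ k u, 0 ≤ u →
      (convPow F k).real (Ioi u) ≤ M * r ^ k * F.real (Ioi u) := by
  have := h.isProbabilityMeasure
  obtain ⟨δ, hδ, rfl⟩ : ∃ δ, 0 < δ ∧ r = 1 + 2 * δ := ⟨(r - 1) / 2, by linarith, by ring⟩
  obtain ⟨a, ha, hA⟩ : ∃ a, 0 ≤ a ∧ ∀ u, a ≤ u →
      (F ∗ F).real (Ioi u) - F.real (Ioi u) ≤ (1 + δ) * F.real (Ioi u) := by
    obtain ⟨a, ha⟩ := eventually_atTop.1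
      (h.two_fold.eventually_lt_const (show (2 : ℝ) < 2 + δ by linarith))
    refine ⟨max a 0, le_max_right _ _, fun u hu => ?_⟩
    have := (div_lt_iff₀ (h.tail_pos u)).1 (ha u ((le_max_left _ _).trans hu))
    linarith
  -- Only `δ M ≥ 1` and `M F̄(a) ≥ 1` matter. The second makes the bound trivial for `u < a`. For `u
  -- ≥ a` the recursion gives `F̄(u) + M rᵏ (1 + δ) F̄(u)`, and the first absorbs the lone `F̄(u)`
  -- into the spare `δ` of `r = 1 + 2 δ`.
  set M := (1 + 1 / δ) * (1 + 1 / F.real (Ioi a))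
  have hFa := h.tail_pos a
  have hM1 : 1 / δ ≤ M := by
    have h1 : 0 < 1 / δ := by positivity
    have h2 : 0 < 1 / F.real (Ioi a) := by positivity
    nlinarith
  have hM2 : 1 / F.real (Ioi a) ≤ M := by
    have h1 : 0 < 1 / δ := by positivity
    have h2 : 0 < 1 / F.real (Ioi a) := by positivity
    nlinarith
  have hM : 0 < M := by positivity
  refine ⟨M, hM.le, fun k => ?_⟩
  induction k with
  | zero =>
    intro u hu
    rw [convPow_zero_tail hu]
    positivity
  | succ k ih =>
    intro u hu
    have hFu := h.tail_pos u
    have hrk : 1 ≤ (1 + 2 * δ) ^ k := one_le_pow₀ hr.le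
    rcases le_or_gt a u with hau | hau
    · have h1 := conv_tail_le (μ := convPow F k) h.nonneg le_rfl
        (K := M * (1 + 2 * δ) ^ k) (by positivity) ih u
      have h2 := mul_le_mul_of_nonneg_left (hA u hau)
        (show 0 ≤ M * (1 + 2 * δ) ^ k by positivity)
      have h3 : 1 ≤ δ * (M * (1 + 2 * δ) ^ k) := by
        have h4 : 1 ≤ δ * M := by rwa [div_le_iff₀' hδ] at hM1
        calc (1 : ℝ) ≤ δ * M * (1 + 2 * δ) ^ k := one_le_mul_of_one_le_of_one_le h4 hrk
          _ = _ := by ring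
      rw [sub_zero] at h1
      change (convPow F k ∗ F).real (Ioi u) ≤ _
      rw [pow_succ]
      nlinarith [mul_le_mul_of_nonneg_right h3 hFu.le]
    · have h1 : F.real (Ioi a) ≤ F.real (Ioi u) := antitone_measureReal_Ioi F hau.le
      have h2 : 1 ≤ M * F.real (Ioi a) := by rwa [div_le_iff₀ hFa] at hM2
      calc (convPow F (k + 1)).real (Ioi u) ≤ 1 := measureReal_le_one
        _ ≤ M * F.real (Ioi u) * (1 + 2 * δ) ^ (k + 1) := by
          refine one_le_mul_of_one_le_of_one_le (h2.trans ?_) (one_le_pow₀ hr.le)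
          gcongr
        _ = _ := by ring

/-- Induction on `k`: the lower bound is `conv_tail_ge`, and `conv_tail_le` with any `K > k` has
limit `1 + K (2 - 1)`. -/
theorem IsSubexpTwoFold.tendsto_convPow {F : Measure ℝ} (h : IsSubexpTwoFold F) (k : ℕ) :
    Tendsto (fun u => (convPow F k).real (Ioi u) / F.real (Ioi u)) atTop (𝓝 k) := by
  have := h.isProbabilityMeasure
  induction k with
  | zero =>
    refine (tendsto_const_nhds (x := (0 : ℝ))).congr' ?_ |>.trans (by simp)
    filter_upwards [eventually_ge_atTop 0] with u hu
    rw [convPow_zero_tail hu, zero_div]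
  | succ k ih =>
    refine tendsto_order.2 ⟨fun d hd => ?_, fun d hd => ?_⟩
    · have hl : Tendsto (fun u => (convPow F k).real (Ioi u) / F.real (Ioi u) + 1 -
          (convPow F k).real (Ioi u)) atTop (𝓝 ((k + 1 : ℕ) : ℝ)) := by
        simpa using (ih.add_const 1).sub (tendsto_measureReal_Ioi (convPow F k))
      filter_upwards [hl.eventually_const_lt hd] with u hu
      refine hu.trans_le ?_
      have hFu := h.tail_pos u
      rw [le_div_iff₀ hFu, sub_mul, add_mul, div_mul_cancel₀ _ hFu.ne', one_mul]
      exact conv_tail_ge (convPow_nonneg h.nonneg k) h.nonneg u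
    · obtain ⟨K, hkK, hKd⟩ : ∃ K : ℝ, (k : ℝ) < K ∧ 1 + K < d :=
        ⟨(k + (d - 1)) / 2, by push_cast at hd; linarith, by push_cast at hd; linarith⟩
      obtain ⟨a, ha⟩ := eventually_atTop.1 (ih.eventually_lt_const hkK)
      have hl : Tendsto (fun u => F.real (Ioi (u - max a 0)) / F.real (Ioi u) +
          K * ((F ∗ F).real (Ioi u) / F.real (Ioi u) - 1)) atTop (𝓝 (1 + K)) := by
        have := (h.long_tailed (le_max_right a 0)).add
          ((h.two_fold.sub_const 1).const_mul K)
        convert this using 2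
        ring
      filter_upwards [hl.eventually_lt_const hKd] with u hu
      refine lt_of_le_of_lt ?_ hu
      have hFu := h.tail_pos u
      rw [div_le_iff₀ hFu]
      refine (conv_tail_le (μ := convPow F k) h.nonneg (le_max_right a 0)
        (show 0 ≤ K from k.cast_nonneg.trans hkK.le) (fun t ht => ?_) u).trans_eq ?_
      · exact ((div_lt_iff₀ (h.tail_pos t)).1 (ha t ((le_max_left _ _).trans ht))).le
      · field_simp

/-! ### Matrix exponentials of intensity matrices -/

section IntensityMatrix

variable {E : Type*} [Fintype E] [DecidableEq E]

open scoped Matrix.Norms.Operator Nat in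
theorem hasSum_matrix_exp (A : Matrix E E ℝ) :
    HasSum (fun n : ℕ => ((n ! : ℝ)⁻¹) • A ^ n) (NormedSpace.exp A) := by
  have := NormedSpace.exp_series_hasSum_exp' (𝕂 := ℝ) A
  exact this

open scoped Nat in
theorem hasSum_matrix_exp_apply (A : Matrix E E ℝ) (i j : E) :
    HasSum (fun n : ℕ => (n ! : ℝ)⁻¹ * (A ^ n) i j) (NormedSpace.exp A i j) := by
  have h := (Pi.hasSum.1 (Pi.hasSum.1 (hasSum_matrix_exp A) i)) j
  simpa using h

theorem matrix_exp_nonneg_of_nonneg {A : Matrix E E ℝ} (hA : ∀ i j, 0 ≤ A i j) (i j : E) :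
    0 ≤ NormedSpace.exp A i j := by
  have hpow : ∀ n : ℕ, ∀ i j, 0 ≤ (A ^ n) i j := by
    intro n
    induction n with
    | zero => intro i j; rw [pow_zero, Matrix.one_apply]; split_ifs <;> norm_num
    | succ n ih =>
      intro i j
      rw [pow_succ, Matrix.mul_apply]
      exact Finset.sum_nonneg fun k _ => mul_nonneg (ih i k) (hA k j)
  exact (hasSum_matrix_exp_apply A i j).nonneg fun n => mul_nonneg (by positivity) (hpow n i j)

theorem matrix_exp_add_smul_one (A : Matrix E E ℝ) (c : ℝ) :
    NormedSpace.exp (A + c • (1 : Matrix E E ℝ)) = Real.exp c • NormedSpace.exp A := by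
  have h1 : NormedSpace.exp (c • (1 : Matrix E E ℝ)) = Real.exp c • (1 : Matrix E E ℝ) := by
    rw [← Matrix.diagonal_one, ← Matrix.diagonal_smul, Matrix.exp_diagonal,
      ← Matrix.diagonal_smul]
    congr 1
    ext i
    simp [Pi.coe_exp, Real.exp_eq_exp_ℝ]
  rw [Matrix.exp_add_of_commute _ _ ((Commute.one_right A).smul_right c), h1, mul_smul_comm,
    mul_one]

/-- A large multiple of the identity makes all entries nonnegative and changes the exponential only
by a positive scalar factor. -/
theorem matrix_exp_nonneg {A : Matrix E E ℝ} (hA : ∀ i j, i ≠ j → 0 ≤ A i j) (i j : E) :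
    0 ≤ NormedSpace.exp A i j := by
  set c := ∑ i, |A i i|
  have h : 0 ≤ NormedSpace.exp (A + c • (1 : Matrix E E ℝ)) i j := by
    refine matrix_exp_nonneg_of_nonneg (fun i j => ?_) i j
    by_cases hij : i = j
    · subst hij
      have : |A i i| ≤ c :=
        Finset.single_le_sum (f := fun i => |A i i|) (fun _ _ => abs_nonneg _)
          (Finset.mem_univ i)
      simp only [Matrix.add_apply, Matrix.smul_apply, Matrix.one_apply_eq, smul_eq_mul, mul_one]
      linarith [neg_abs_le (A i i)]
    · simpa [hij] using hA i j hij
  rw [matrix_exp_add_smul_one] at h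
  exact nonneg_of_mul_nonneg_right h (Real.exp_pos c)

theorem matrix_exp_row_sum {A : Matrix E E ℝ} (hA : ∀ i, ∑ j, A i j = 0) (i : E) :
    ∑ j, NormedSpace.exp A i j = 1 := by
  have hpow : ∀ n : ℕ, ∀ i, ∑ j, (A ^ (n + 1)) i j = 0 := by
    intro n i
    simp_rw [pow_succ, Matrix.mul_apply]
    rw [Finset.sum_comm]
    simp [← Finset.mul_sum, hA]
  have h1 := hasSum_sum fun j (_ : j ∈ Finset.univ) => hasSum_matrix_exp_apply A i j
  refine h1.unique ?_
  convert! hasSum_single (f := fun n : ℕ => ∑ j, ((n.factorial : ℝ))⁻¹ * (A ^ n) i j) 0 ?_ using 1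
  · simp [Matrix.one_apply]
  · intro n hn
    obtain ⟨n, rfl⟩ := Nat.exists_eq_succ_of_ne_zero hn
    rw [← Finset.mul_sum, hpow, mul_zero]

theorem matrix_exp_zero_row {A : Matrix E E ℝ} {i : E} (hA : ∀ j, A i j = 0) (j : E) :
    NormedSpace.exp A i j = (1 : Matrix E E ℝ) i j := by
  refine (hasSum_matrix_exp_apply A i j).unique ?_
  convert! hasSum_single (f := fun n : ℕ => ((n.factorial : ℝ))⁻¹ * (A ^ n) i j) 0 ?_ using 1
  · simp
  · intro n hn
    obtain ⟨n, rfl⟩ := Nat.exists_eq_succ_of_ne_zero hn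
    simp [Nat.succ_eq_add_one, pow_succ', Matrix.mul_apply, hA]

end IntensityMatrix

/-! ### Exponential tails of phase-type distributions -/

section PhaseType

variable {p : ℕ} {T : Matrix (Fin p) (Fin p) ℝ}

theorem phaseGenerator_offDiag (hT : IsTransientSubIntensity T) {t : ℝ} (ht : 0 ≤ t)
    (a b : Option (Fin p)) (hab : a ≠ b) : 0 ≤ (t • phaseGenerator T) a b := by
  refine mul_nonneg ht ?_
  rcases a with _ | i
  · simp [phaseGenerator]
  · rcases b with _ | j
    · simpa [phaseGenerator] using hT.row_sum_nonpos i
    · exact hT.off_diag_nonneg i j (by simpa using hab)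

theorem phaseGenerator_row_sum (t : ℝ) (a : Option (Fin p)) :
    ∑ b, (t • phaseGenerator T) a b = 0 := by
  rw [Fintype.sum_option]
  rcases a with _ | i <;> simp [phaseGenerator, ← Finset.mul_sum]

/-- The probability that a chain with intensity matrix `phaseGenerator T` started in `a` has not
been absorbed at time `t`. -/
noncomputable def survival (T : Matrix (Fin p) (Fin p) ℝ) (t : ℝ) (a : Option (Fin p)) : ℝ :=
  ∑ i : Fin p, NormedSpace.exp (t • phaseGenerator T) a (some i)

theorem survival_eq_one_sub (T : Matrix (Fin p) (Fin p) ℝ) (t : ℝ) (a : Option (Fin p)) :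
    survival T t a = 1 - NormedSpace.exp (t • phaseGenerator T) a none := by
  have := matrix_exp_row_sum (phaseGenerator_row_sum (T := T) t) a
  rw [Fintype.sum_option] at this
  rw [survival]
  linarith

theorem survival_none (T : Matrix (Fin p) (Fin p) ℝ) (t : ℝ) : survival T t none = 0 := by
  refine Finset.sum_eq_zero fun i _ => ?_
  rw [matrix_exp_zero_row (fun j => by simp [phaseGenerator])]
  simp

theorem survival_le_one (hT : IsTransientSubIntensity T) {t : ℝ} (ht : 0 ≤ t)
    (a : Option (Fin p)) : survival T t a ≤ 1 := by
  rw [survival_eq_one_sub]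
  linarith [matrix_exp_nonneg (phaseGenerator_offDiag hT ht) a none]

theorem survival_add (T : Matrix (Fin p) (Fin p) ℝ) (s t : ℝ) (a : Option (Fin p)) :
    survival T (s + t) a =
      ∑ i : Fin p, NormedSpace.exp (s • phaseGenerator T) a (some i) *
        survival T t (some i) := by
  have h : NormedSpace.exp ((s + t) • phaseGenerator T) =
      NormedSpace.exp (s • phaseGenerator T) * NormedSpace.exp (t • phaseGenerator T) := by
    rw [add_smul, Matrix.exp_add_of_commute]
    exact ((Commute.refl _).smul_left s).smul_right t
  have h2 : survival T (s + t) a = ∑ b, NormedSpace.exp (s • phaseGenerator T) a b *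
      survival T t b := by
    simp only [survival, h, Matrix.mul_apply, Finset.mul_sum]
    rw [Finset.sum_comm]
  rw [h2, Fintype.sum_option, survival_none, mul_zero, zero_add]

theorem survival_add_le (hT : IsTransientSubIntensity T) {s t θ : ℝ} (hs : 0 ≤ s)
    (hθ : ∀ i, survival T t (some i) ≤ θ) (a : Option (Fin p)) :
    survival T (s + t) a ≤ survival T s a * θ := by
  rw [survival_add, survival, Finset.sum_mul]
  exact Finset.sum_le_sum fun i _ => mul_le_mul_of_nonneg_left (hθ i)
    (matrix_exp_nonneg (phaseGenerator_offDiag hT hs) _ _)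

theorem survival_antitone (hT : IsTransientSubIntensity T) {s t : ℝ} (hs : 0 ≤ s)
    (hst : s ≤ t) (a : Option (Fin p)) : survival T t a ≤ survival T s a := by
  have := survival_add_le hT hs (t := t - s) (θ := 1)
    (fun i => survival_le_one hT (sub_nonneg.2 hst) _) a
  rwa [add_sub_cancel, mul_one] at this

/-- By a common time `t₀` absorption has positive probability from every state. Finiteness gives a
uniform survival bound `θ < 1` over a period `t₀`, and the semigroup property iterates it. -/
theorem survival_exp_decay (hT : IsTransientSubIntensity T) :
    ∃ C δ : ℝ, 1 ≤ C ∧ 0 < δ ∧ ∀ t a, 0 ≤ t → survival T t a ≤ C * Real.exp (-δ * t) := by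
  choose τ hτ0 hτ using hT.transient
  -- The sum dominates every `τ i`; the `1` keeps `t₀` positive, also when there are no transient
  -- states.
  set t₀ := ∑ i, τ i + 1
  have hsum : 0 ≤ ∑ i, τ i := Finset.sum_nonneg fun i _ => hτ0 i
  have ht₀ : 0 < t₀ := by positivity
  have hlt : ∀ i, survival T t₀ (some i) < 1 := by
    intro i
    have h1 : τ i ≤ t₀ :=
      (Finset.single_le_sum (fun i _ => hτ0 i) (Finset.mem_univ i)).trans (by simp [t₀])
    refine (survival_antitone hT (hτ0 i) h1 _).trans_lt ?_
    rw [survival_eq_one_sub]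
    linarith [hτ i]
  obtain ⟨θ, hθ, hθ0, hθ1⟩ : ∃ θ, (∀ i, survival T t₀ (some i) < θ) ∧ 0 < θ ∧ θ < 1 := by
    have h1 : ∀ᶠ θ in 𝓝[<] (1 : ℝ), ∀ i, survival T t₀ (some i) < θ :=
      eventually_all.2 fun i => by
        filter_upwards [Ioo_mem_nhdsLT (hlt i)] with θ h using h.1
    obtain ⟨θ, h, h'⟩ := (h1.and (Ioo_mem_nhdsLT (zero_lt_one (α := ℝ)))).exists
    exact ⟨θ, h, h'.1, h'.2⟩
  have iter : ∀ (k : ℕ) a, survival T (k * t₀) a ≤ θ ^ k := by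
    intro k
    induction k with
    | zero => intro a; simpa using survival_le_one hT le_rfl a
    | succ k ih =>
      intro a
      have := survival_add_le hT (s := k * t₀) (by positivity) (fun i => (hθ i).le) a
      rw [show ((k + 1 : ℕ) : ℝ) * t₀ = k * t₀ + t₀ by push_cast; ring, pow_succ]
      exact this.trans (mul_le_mul_of_nonneg_right (ih a) hθ0.le)
  -- The factor `θ⁻¹` pays for rounding `t / t₀` down to an integer.
  refine ⟨θ⁻¹, -Real.log θ / t₀, (one_le_inv₀ hθ0).2 hθ1.le,
    div_pos (neg_pos.2 (Real.log_neg hθ0 hθ1)) ht₀, fun t a ht => ?_⟩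
  have hk := Nat.floor_le (div_nonneg ht ht₀.le)
  have hk' := Nat.lt_floor_add_one (t / t₀)
  refine (survival_antitone hT (by positivity) ((le_div_iff₀ ht₀).1 hk) a).trans
    ((iter _ a).trans ?_)
  have e : θ⁻¹ * Real.exp (-(-Real.log θ / t₀) * t) = θ ^ (t / t₀ - 1) := by
    rw [Real.rpow_def_of_pos hθ0, ← Real.exp_log (inv_pos.2 hθ0), Real.log_inv, ← Real.exp_add]
    congr 1
    field_simp
    ring
  rw [e, ← Real.rpow_natCast]
  exact Real.rpow_le_rpow_of_exponent_ge hθ0 hθ1.le (by linarith)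

end PhaseType

theorem IsPhaseType.nonneg {μ : Measure ℝ} (h : IsPhaseType μ) : μ (Iio 0) = 0 := by
  obtain ⟨p, π, T, -, -, -, Ω, _, P, _, X, -, hlaw⟩ := h
  rw [← hlaw.map_eq, Measure.map_apply_of_aemeasurable hlaw.aemeasurable measurableSet_Iio]
  convert measure_empty (μ := P)
  ext ω
  simp only [mem_preimage, mem_Iio, mem_empty_iff_false, iff_false, not_lt]
  refine Real.sInf_nonneg ?_
  rintro t ⟨r, -, rfl, -⟩
  exact r.2

theorem IsPhaseType.isProbabilityMeasure {μ : Measure ℝ} (h : IsPhaseType μ) :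
    IsProbabilityMeasure μ := by
  obtain ⟨p, π, T, -, -, -, Ω, _, P, hP, X, -, hlaw⟩ := h
  exact hlaw.isProbabilityMeasure_iff.1 hP

theorem IsPhaseType.exp_tail {μ : Measure ℝ} (h : IsPhaseType μ) :
    ∃ C δ : ℝ, 0 < C ∧ 0 < δ ∧ ∀ t, 0 < t → μ.real (Ioi t) ≤ C * Real.exp (-δ * t) := by
  obtain ⟨p, π, T, hπ0, hπ1, hT, Ω, _, P, hP, X, hX, hlaw⟩ := h
  obtain ⟨C, δ, hC, hδ, hdecay⟩ := survival_exp_decay hT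
  refine ⟨C, δ, by linarith, hδ, fun t ht => ?_⟩
  obtain ⟨r, rfl⟩ : ∃ r : ℝ≥0, (r : ℝ) = t := ⟨⟨t, ht.le⟩, rfl⟩
  have hmarg : ∀ s₀ s₁, P.real {ω | X 0 ω = s₀ ∧ X r ω = s₁} =
      s₀.elim 0 π * NormedSpace.exp ((r : ℝ) • phaseGenerator T) s₀ s₁ := by
    intro s₀ s₁
    have := hX.fin_dim 1 ![0, r] ![s₀, s₁] rfl (by
      intro i j hij
      fin_cases i <;> fin_cases j <;> simp_all)
    simpa [Fin.forall_fin_two] using this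
  -- If `X r = none` then, as `r > 0`, `r` belongs to the set whose infimum is the absorption time.
  -- Hence late absorption forces a transient state at `r`, and two-time marginals suffice.
  have hsub : absorptionTime X ⁻¹' Ioi (r : ℝ) ⊆
      ⋃ s : Option (Fin p) × Fin p, {ω | X 0 ω = s.1 ∧ X r ω = some s.2} := by
    intro ω hω
    have hne : X r ω ≠ none := by
      intro hnone
      have : absorptionTime X ω ≤ r := by
        refine csInf_le ⟨0, ?_⟩ ⟨r, ht, rfl, hnone⟩
        rintro _ ⟨q, -, rfl, -⟩
        exact q.2
      exact absurd hω (not_lt.2 this)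
    obtain ⟨i, hi⟩ := Option.ne_none_iff_exists'.1 hne
    exact mem_iUnion.2 ⟨(X 0 ω, i), rfl, hi⟩
  rw [← hlaw.map_eq, map_measureReal_apply_of_aemeasurable hlaw.aemeasurable measurableSet_Ioi]
  refine (measureReal_mono hsub).trans ((measureReal_iUnion_fintype_le _).trans ?_)
  simp only [hmarg]
  rw [Fintype.sum_prod_type]
  simp only [← Finset.mul_sum]
  change ∑ s : Option (Fin p), s.elim 0 π * survival T r s ≤ _
  rw [Fintype.sum_option]
  simp only [Option.elim_none, zero_mul, zero_add, Option.elim_some]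
  calc ∑ i, π i * survival T r (some i) ≤ ∑ i, π i * (C * Real.exp (-δ * r)) :=
        Finset.sum_le_sum fun i _ => mul_le_mul_of_nonneg_left (hdecay r _ ht.le) (hπ0 i)
    _ = _ := by rw [← Finset.sum_mul, hπ1, one_mul]

/-! ### Stationary excess laws -/

section ExcessLaw

variable {μ : Measure ℝ}

theorem integrableOn_tail (h0 : μ (Iio 0) = 0) (hint : Integrable (fun x : ℝ => x) μ) :
    IntegrableOn (fun t => μ.real (Ioi t)) (Ioi 0) := by
  have key := lintegral_eq_lintegral_meas_lt μ (f := fun x => x)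
    (ae_nonneg_of_measure_Iio h0) hint.aemeasurable
  refine integrable_toReal_of_lintegral_ne_top (f := fun t => μ (Ioi t)) ?_ ?_
  · exact (Antitone.measurable fun _ _ h => measure_mono (Ioi_subset_Ioi h)).aemeasurable
  · exact (key ▸ hint.lintegral_lt_top).ne

theorem lawMean_eq_integral_tail (h0 : μ (Iio 0) = 0)
    (hint : Integrable (fun x : ℝ => x) μ) :
    lawMean μ = ∫ t in Ioi 0, μ.real (Ioi t) :=
  hint.integral_eq_integral_meas_lt (ae_nonneg_of_measure_Iio h0)

theorem lawMean_nonneg (h0 : μ (Iio 0) = 0) : 0 ≤ lawMean μ :=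
  integral_nonneg_of_ae (ae_nonneg_of_measure_Iio h0)

theorem excessLaw_Ioi (h0 : μ (Iio 0) = 0) (hint : Integrable (fun x : ℝ => x) μ) {u : ℝ}
    (hu : 0 ≤ u) :
    excessLaw μ (Ioi u) = ENNReal.ofReal ((∫ x in Ioi u, μ.real (Ioi x)) / lawMean μ) := by
  rw [excessLaw, withDensity_apply _ measurableSet_Ioi,
    Measure.restrict_restrict measurableSet_Ioi,
    inter_eq_left.2 (Ioi_subset_Ioi hu), ← integral_div, ofReal_integral_eq_lintegral_ofReal]
  · exact ((integrableOn_tail h0 hint).mono_set (Ioi_subset_Ioi hu)).div_const _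
  · exact Eventually.of_forall fun x => div_nonneg measureReal_nonneg (lawMean_nonneg h0)

theorem excessLaw_real_Ioi (h0 : μ (Iio 0) = 0) (hint : Integrable (fun x : ℝ => x) μ) {u : ℝ}
    (hu : 0 ≤ u) :
    (excessLaw μ).real (Ioi u) = (∫ x in Ioi u, μ.real (Ioi x)) / lawMean μ := by
  rw [measureReal_def, excessLaw_Ioi h0 hint hu, ENNReal.toReal_ofReal]
  exact div_nonneg (integral_nonneg fun _ => measureReal_nonneg) (lawMean_nonneg h0)

theorem excessLaw_Iic (μ : Measure ℝ) : excessLaw μ (Iic 0) = 0 := by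
  rw [excessLaw, withDensity_apply _ measurableSet_Iic,
    Measure.restrict_restrict measurableSet_Iic, Iic_inter_Ioi, Ioc_self,
    Measure.restrict_empty, lintegral_zero_measure]

theorem excessLaw_Iio (μ : Measure ℝ) : excessLaw μ (Iio 0) = 0 :=
  measure_mono_null Iio_subset_Iic_self (excessLaw_Iic μ)

theorem excessLaw_isProbabilityMeasure (h0 : μ (Iio 0) = 0)
    (hint : Integrable (fun x : ℝ => x) μ) (hm : 0 < lawMean μ) :
    IsProbabilityMeasure (excessLaw μ) := by
  refine ⟨?_⟩
  rw [← Iic_union_Ioi (a := (0 : ℝ)), measure_union (by simp) measurableSet_Ioi,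
    excessLaw_Iic, zero_add, excessLaw_Ioi h0 hint le_rfl, ← lawMean_eq_integral_tail h0 hint,
    div_self hm.ne', ENNReal.ofReal_one]

/-- With mean `0` the density is a division by zero, and the excess law would be the zero measure.
-/
theorem lawMean_pos_of_excessLaw (h0 : μ (Iio 0) = 0)
    (h : IsProbabilityMeasure (excessLaw μ)) : 0 < lawMean μ := by
  refine (lawMean_nonneg h0).lt_of_ne' fun hm => ?_
  have h1 := h.measure_univ
  simp [excessLaw, hm] at h1

end ExcessLaw

section Mixture

variable {ε : ℝ} {light heavy : Measure ℝ}

theorem mixtureLaw_isProbabilityMeasure [IsProbabilityMeasure light]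
    [IsProbabilityMeasure heavy] (hε : ε ∈ Ioo (0 : ℝ) 1) :
    IsProbabilityMeasure (mixtureLaw ε light heavy) := by
  refine ⟨?_⟩
  simp only [mixtureLaw, Measure.add_apply, Measure.smul_apply, measure_univ, smul_eq_mul,
    mul_one]
  rw [← ENNReal.ofReal_add (by linarith [hε.2]) hε.1.le]
  simp

theorem mixtureLaw_real [IsFiniteMeasure light] [IsFiniteMeasure heavy]
    (hε : ε ∈ Ioo (0 : ℝ) 1) (s : Set ℝ) :
    (mixtureLaw ε light heavy).real s = (1 - ε) * light.real s + ε * heavy.real s := by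
  have h1 : 0 ≤ 1 - ε := by linarith [hε.2]
  rw [mixtureLaw, measureReal_def, Measure.add_apply, Measure.smul_apply, Measure.smul_apply,
    smul_eq_mul, smul_eq_mul, ENNReal.toReal_add (by finiteness) (by finiteness),
    ENNReal.toReal_mul, ENNReal.toReal_mul, ENNReal.toReal_ofReal h1,
    ENNReal.toReal_ofReal hε.1.le]
  rfl

theorem mixtureLaw_Iio (hl : light (Iio 0) = 0) (hh : heavy (Iio 0) = 0) :
    mixtureLaw ε light heavy (Iio 0) = 0 := by
  simp [mixtureLaw, hl, hh]

theorem mixtureLaw_integrable (hl : Integrable (fun x : ℝ => x) light)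
    (hh : Integrable (fun x : ℝ => x) heavy) :
    Integrable (fun x : ℝ => x) (mixtureLaw ε light heavy) :=
  (hl.smul_measure ENNReal.ofReal_ne_top).add_measure (hh.smul_measure ENNReal.ofReal_ne_top)

theorem lawMean_mixtureLaw (hε : ε ∈ Ioo (0 : ℝ) 1)
    (hl : Integrable (fun x : ℝ => x) light) (hh : Integrable (fun x : ℝ => x) heavy) :
    lawMean (mixtureLaw ε light heavy) = (1 - ε) * lawMean light + ε * lawMean heavy := by
  have h1 : 0 ≤ 1 - ε := by linarith [hε.2]
  rw [lawMean, mixtureLaw, integral_add_measure (hl.smul_measure ENNReal.ofReal_ne_top)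
    (hh.smul_measure ENNReal.ofReal_ne_top), integral_smul_measure, integral_smul_measure,
    ENNReal.toReal_ofReal h1, ENNReal.toReal_ofReal hε.1.le]
  rfl

/-- The tail of the excess law of a mixture of a light-tailed and a heavy-tailed law is governed
by the heavy-tailed component. -/
theorem tendsto_excessLaw_mixtureLaw [IsProbabilityMeasure light] [IsProbabilityMeasure heavy]
    (hε : ε ∈ Ioo (0 : ℝ) 1) (hl0 : light (Iio 0) = 0) (hh0 : heavy (Iio 0) = 0)
    (hl : Integrable (fun x : ℝ => x) light) (hh : Integrable (fun x : ℝ => x) heavy)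
    {C δ : ℝ} (hδ : 0 < δ)
    (htail : ∀ t, 0 < t → light.real (Ioi t) ≤ C * Real.exp (-δ * t))
    (hH : IsSubexpTwoFold (excessLaw heavy)) :
    Tendsto (fun u => (excessLaw (mixtureLaw ε light heavy)).real (Ioi u) /
        (excessLaw heavy).real (Ioi u)) atTop
      (𝓝 (ε * lawMean heavy / lawMean (mixtureLaw ε light heavy))) := by
  have hmh := lawMean_pos_of_excessLaw hh0 hH.isProbabilityMeasure
  have hB := mixtureLaw_isProbabilityMeasure (light := light) (heavy := heavy) hε
  have hB0 := mixtureLaw_Iio (ε := ε) hl0 hh0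
  have hBi := mixtureLaw_integrable (ε := ε) hl hh
  set m := lawMean (mixtureLaw ε light heavy)
  -- The integrated light tail is at most `(C / δ) exp (-δ u)`, negligible against the long-tailed
  -- heavy excess law.
  have hlight : Tendsto (fun u => (∫ x in Ioi u, light.real (Ioi x)) /
      (excessLaw heavy).real (Ioi u)) atTop (𝓝 0) := by
    have hlim := (hH.exp_div_tail hδ).const_mul (C / δ)
    rw [mul_zero] at hlim
    refine tendsto_of_tendsto_of_tendsto_of_le_of_le' tendsto_const_nhds hlim ?_ ?_
    · exact Eventually.of_forall fun u =>
        div_nonneg (integral_nonneg fun _ => measureReal_nonneg) (hH.tail_pos u).le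
    · filter_upwards [eventually_ge_atTop 0] with u hu
      rw [← mul_div_assoc]
      refine div_le_div_of_nonneg_right ?_ (hH.tail_pos u).le
      calc ∫ x in Ioi u, light.real (Ioi x) ≤ ∫ x in Ioi u, C * Real.exp (-δ * x) := by
            refine setIntegral_mono_on
              ((integrableOn_tail hl0 hl).mono_set (Ioi_subset_Ioi hu))
              ((integrableOn_exp_mul_Ioi (neg_lt_zero.2 hδ) u).const_mul C)
              measurableSet_Ioi fun x hx => htail x (hu.trans_lt hx)
        _ = C / δ * Real.exp (-δ * u) := by
            rw [integral_const_mul, integral_exp_mul_Ioi (neg_lt_zero.2 hδ)]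
            field_simp
  have hmain := (hlight.const_mul ((1 - ε) / m)).add_const (ε * lawMean heavy / m)
  rw [mul_zero, zero_add] at hmain
  refine hmain.congr' ?_
  filter_upwards [eventually_ge_atTop 0] with u hu
  have hne := (hH.tail_pos u).ne'
  have e2 : ∫ x in Ioi u, heavy.real (Ioi x) =
      (excessLaw heavy).real (Ioi u) * lawMean heavy := by
    rw [excessLaw_real_Ioi hh0 hh hu, div_mul_cancel₀ _ hmh.ne']
  rw [excessLaw_real_Ioi hB0 hBi hu]
  simp only [mixtureLaw_real hε]
  rw [integral_add (((integrableOn_tail hl0 hl).mono_set (Ioi_subset_Ioi hu)).const_mul _)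
    (((integrableOn_tail hh0 hh).mono_set (Ioi_subset_Ioi hu)).const_mul _),
    integral_const_mul, integral_const_mul, e2]
  field_simp
  rfl

end Mixture

/-! ### Sums and maxima of i.i.d. sequences -/

section Iid

variable {F : Measure ℝ} [IsProbabilityMeasure F]

theorem map_sum_infinitePi (k : ℕ) :
    (Measure.infinitePi fun _ : ℕ => F).map (fun x => ∑ i ∈ Finset.range k, x i) =
      convPow F k := by
  induction k with
  | zero => simp [convPow, Measure.map_const]
  | succ k ih =>
    have hind : iIndepFun (fun (i : ℕ) (x : ℕ → ℝ) => x i)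
        (Measure.infinitePi fun _ : ℕ => F) :=
      iIndepFun_infinitePi (X := fun _ x => x) fun _ => measurable_id
    have h := (hind.indepFun_finsetSum_of_notMem (fun i => measurable_pi_apply i)
      (s := Finset.range k) (i := k) (by simp)).map_add_eq_map_conv_map₀
        (by fun_prop) (measurable_pi_apply k).aemeasurable
    have e : (∑ j ∈ Finset.range k, fun x : ℕ → ℝ => x j) =
        fun x => ∑ j ∈ Finset.range k, x j := by
      ext x; simp
    rw [e, ih, Measure.infinitePi_map_eval] at h
    rw [convPow, ← h]
    congr 1
    ext x
    simp [Finset.sum_range_succ]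

theorem infinitePi_sum_tail (k : ℕ) (u : ℝ) :
    (Measure.infinitePi fun _ : ℕ => F).real {x | u < ∑ i ∈ Finset.range k, x i} =
      (convPow F k).real (Ioi u) := by
  rw [← map_sum_infinitePi, map_measureReal_apply (by fun_prop) measurableSet_Ioi]
  rfl

theorem measurableSet_exists_lt (k : ℕ) (u : ℝ) :
    MeasurableSet {x : ℕ → ℝ | ∃ i ∈ Finset.range k, u < x i} := by
  have : {x : ℕ → ℝ | ∃ i ∈ Finset.range k, u < x i} =
      ⋃ i ∈ Finset.range k, {x | u < x i} := by
    ext x; simp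
  rw [this]
  exact Finset.measurableSet_biUnion _ fun i _ =>
    measurableSet_lt measurable_const (measurable_pi_apply i)

theorem infinitePi_max_tail (k : ℕ) (u : ℝ) :
    (Measure.infinitePi fun _ : ℕ => F).real {x | ∃ i ∈ Finset.range k, u < x i} =
      1 - (1 - F.real (Ioi u)) ^ k := by
  have h : {x : ℕ → ℝ | ∃ i ∈ Finset.range k, u < x i} =
      (Set.pi (Finset.range k : Set ℕ) fun _ => Iic u)ᶜ := by
    ext x
    simp [Set.mem_pi]
  have hm : MeasurableSet (Set.pi (Finset.range k : Set ℕ) fun _ => Iic u) :=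
    MeasurableSet.pi (Finset.countable_toSet _) fun _ _ => measurableSet_Iic
  rw [h, probReal_compl_eq_one_sub hm, measureReal_def,
    Measure.infinitePi_pi _ fun _ _ => measurableSet_Iic]
  simp only [Finset.prod_const, Finset.card_range, ENNReal.toReal_pow]
  rw [← measureReal_def, measureReal_Iic_eq]

theorem infinitePi_ae_nonneg (hF : F (Iio 0) = 0) :
    ∀ᵐ x ∂(Measure.infinitePi fun _ : ℕ => F), ∀ i, 0 ≤ x i :=
  ae_all_iff.2 fun i =>
    (measurePreserving_eval_infinitePi (fun _ : ℕ => F) i).quasiMeasurePreserving.ae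
      (ae_nonneg_of_measure_Iio hF)

end Iid

/-! ### The Pollaczek–Khinchine variables -/

section PK

variable {F : Measure ℝ} [IsProbabilityMeasure F] {ρ : ℝ}

instance pkLaw_isProbabilityMeasure : IsProbabilityMeasure (pkLaw ρ F) := by
  rw [pkLaw]; infer_instance

theorem measurable_pkSum : Measurable pkSum := by
  refine measurable_from_prod_countable_right fun k => ?_
  simp only [pkSum]
  fun_prop

/-- For `u ≥ 0` the value `0` assigned when `N + 2 > n` never counts as an exceedance. -/
theorem lt_pkTruncMax_iff {n : ℕ} {u : ℝ} (hu : 0 ≤ u) (x : ℕ × (ℕ → ℝ)) :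
    u < pkTruncMax n x ↔ x.1 + 2 ≤ n ∧ ∃ i ∈ Finset.range (x.1 + 2), u < x.2 i := by
  rw [pkTruncMax]
  split_ifs with h
  · rw [Finset.lt_sup'_iff]
    simp [h]
  · simp [h, hu]

theorem measurableSet_lt_pkSum (u : ℝ) : MeasurableSet {x | u < pkSum x} :=
  measurableSet_lt measurable_const measurable_pkSum

theorem measurableSet_lt_pkTruncMax (n : ℕ) {u : ℝ} (hu : 0 ≤ u) :
    MeasurableSet {x | u < pkTruncMax n x} := by
  simp only [lt_pkTruncMax_iff hu]
  have : {x : ℕ × (ℕ → ℝ) | x.1 + 2 ≤ n ∧ ∃ i ∈ Finset.range (x.1 + 2), u < x.2 i} =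
      ⋃ k : ℕ, {k} ×ˢ {y | k + 2 ≤ n ∧ ∃ i ∈ Finset.range (k + 2), u < y i} := by
    ext x
    simp
  rw [this]
  exact MeasurableSet.iUnion fun k => (measurableSet_singleton k).prod
    ((MeasurableSet.const _).inter (measurableSet_exists_lt (k + 2) u))

theorem pkLaw_ae_lt_pkSum (hF : F (Iio 0) = 0) {n : ℕ} {u : ℝ} (hu : 0 ≤ u) :
    ∀ᵐ x ∂(pkLaw ρ F), u < pkTruncMax n x → u < pkSum x := by
  have h : ∀ᵐ x ∂(pkLaw ρ F), ∀ i, 0 ≤ x.2 i :=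
    Measure.quasiMeasurePreserving_snd.ae (infinitePi_ae_nonneg hF)
  filter_upwards [h] with x hx hlt
  obtain ⟨-, i, hi, hui⟩ := (lt_pkTruncMax_iff hu x).1 hlt
  exact hui.trans_le (Finset.single_le_sum (f := fun i => x.2 i) (fun i _ => hx i) hi)

theorem hasSum_pkLaw_real (hρ : ρ ∈ Ioo (0 : ℝ) 1) {S : Set (ℕ × (ℕ → ℝ))}
    (hS : MeasurableSet S) :
    HasSum (fun k => (1 - ρ) * ρ ^ k *
      (Measure.infinitePi fun _ : ℕ => F).real (Prod.mk k ⁻¹' S)) ((pkLaw ρ F).real S) := by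
  have hmem : 1 - ρ ∈ Icc (0 : ℝ) 1 := ⟨by linarith [hρ.2], by linarith [hρ.1]⟩
  set p := projIcc (0 : ℝ) 1 zero_le_one (1 - ρ)
  have hp : (p : ℝ) = 1 - ρ := by simp only [p]; rw [projIcc_of_mem _ hmem]
  have hp0 : p ≠ 0 := by
    intro h
    rw [h] at hp
    have : (0 : ℝ) = 1 - ρ := hp
    linarith [hρ.2]
  have hint : Integrable (fun k => (Measure.infinitePi fun _ : ℕ => F).real (Prod.mk k ⁻¹' S))
      (geometricMeasure p) :=
    Integrable.of_bound Measurable.of_discrete.aestronglyMeasurable 1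
      (Eventually.of_forall fun k => by
        rw [Real.norm_of_nonneg measureReal_nonneg]; exact measureReal_le_one)
  have h := hasSum_integral_geometricMeasure hp0 hint
  have e : (pkLaw ρ F).real S =
      ∫ k, (Measure.infinitePi fun _ : ℕ => F).real (Prod.mk k ⁻¹' S) ∂(geometricMeasure p) := by
    rw [measureReal_def, pkLaw, Measure.prod_apply hS, ← integral_toReal]
    · rfl
    · exact Measurable.of_discrete.aemeasurable
    · exact Eventually.of_forall fun k => measure_lt_top _ _
  rw [e]
  refine h.congr_fun fun k => ?_
  rw [hp, smul_eq_mul, sub_sub_cancel, mul_comm (1 - ρ)]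

theorem hasSum_pkSum_tail (hρ : ρ ∈ Ioo (0 : ℝ) 1) (u : ℝ) :
    HasSum (fun k => (1 - ρ) * ρ ^ k * (convPow F (k + 2)).real (Ioi u))
      ((pkLaw ρ F).real {x | u < pkSum x}) := by
  refine (hasSum_pkLaw_real hρ (measurableSet_lt_pkSum u)).congr_fun fun k => ?_
  rw [← infinitePi_sum_tail]
  rfl

theorem hasSum_pkTruncMax_tail (hρ : ρ ∈ Ioo (0 : ℝ) 1) (n : ℕ) {u : ℝ} (hu : 0 ≤ u) :
    HasSum (fun k => (1 - ρ) * ρ ^ k *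
        if k + 2 ≤ n then 1 - (1 - F.real (Ioi u)) ^ (k + 2) else 0)
      ((pkLaw ρ F).real {x | u < pkTruncMax n x}) := by
  refine (hasSum_pkLaw_real hρ (measurableSet_lt_pkTruncMax n hu)).congr_fun fun k => ?_
  rw [← infinitePi_max_tail]
  congr 1
  simp only [lt_pkTruncMax_iff hu, preimage_ofPred_eq]
  split_ifs with h
  · simp [h]
  · simp [h]

/-- This is `𝔼[(N + 2) 1{N + 2 > n}]`, the source of the constant in the theorem. The terms start at
`k = n - 1`; shifting by it leaves geometric series. -/
theorem hasSum_geometric_tail_mean (hρ : ρ ∈ Ioo (0 : ℝ) 1) {n : ℕ} (hn : 1 ≤ n) :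
    HasSum (fun k : ℕ => (1 - ρ) * ρ ^ k * if k + 2 ≤ n then 0 else ((k + 2 : ℕ) : ℝ))
      (ρ ^ (n - 1) * ((1 + n * (1 - ρ)) / (1 - ρ))) := by
  obtain ⟨m, rfl⟩ := Nat.exists_eq_add_of_le' hn
  have hne : 1 - ρ ≠ 0 := by linarith [hρ.2]
  have hnorm : ‖ρ‖ < 1 := by rw [Real.norm_of_nonneg hρ.1.le]; exact hρ.2
  have hinj : Function.Injective fun j : ℕ => j + m := fun a b h => by simpa using h
  rw [← hinj.hasSum_iff]
  · have h := ((hasSum_coe_mul_geometric_of_norm_lt_one hnorm).add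
      ((hasSum_geometric_of_norm_lt_one hnorm).mul_left ((m : ℝ) + 2))).mul_left
        (ρ ^ m * (1 - ρ))
    convert! h using 1
    · ext j
      have : ¬ (j + m + 2 ≤ m + 1) := by omega
      simp only [Function.comp_apply, this, if_false, pow_add]
      push_cast
      ring
    · simp only [Nat.add_sub_cancel]
      push_cast
      field_simp
      ring
  · intro k hk
    have : k < m := by
      by_contra hkm
      exact hk ⟨k - m, Nat.sub_add_cancel (not_lt.1 hkm)⟩
    rw [if_pos (by omega), mul_zero]

/-- At `x = F̄(u)`: the maximum of `k` claims has tail `~ k F̄(u)`, like their sum. -/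
theorem tendsto_one_sub_pow_div (k : ℕ) :
    Tendsto (fun x : ℝ => (1 - (1 - x) ^ k) / x) (𝓝[≠] 0) (𝓝 k) := by
  have h : Tendsto (fun x : ℝ => ∑ j ∈ Finset.range k, (1 - x) ^ j) (𝓝[≠] 0) (𝓝 k) := by
    have : Continuous fun x : ℝ => ∑ j ∈ Finset.range k, (1 - x) ^ j := by fun_prop
    have h0 := this.tendsto 0
    simp only [sub_zero, one_pow, Finset.sum_const, Finset.card_range, nsmul_eq_mul,
      mul_one] at h0
    exact h0.mono_left nhdsWithin_le_nhds
  refine h.congr' ?_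
  filter_upwards [self_mem_nhdsWithin] with x hx
  have hx0 : x ≠ 0 := hx
  rw [eq_div_iff hx0, ← mul_neg_geom_sum (1 - x) k]
  ring

theorem IsSubexpTwoFold.tendsto_pkLaw_diff (h : IsSubexpTwoFold F) (hρ : ρ ∈ Ioo (0 : ℝ) 1)
    {n : ℕ} (hn : 1 ≤ n) :
    Tendsto (fun u => ((pkLaw ρ F).real {x | u < pkSum x} -
        (pkLaw ρ F).real {x | u < pkTruncMax n x}) / F.real (Ioi u)) atTop
      (𝓝 (ρ ^ (n - 1) * ((1 + n * (1 - ρ)) / (1 - ρ)))) := by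
  -- Kesten's bound with `r < 1 / ρ` still leaves a convergent geometric series.
  obtain ⟨r, hr1, hr0, hρr⟩ : ∃ r : ℝ, 1 < r ∧ 0 < r ∧ ρ * r < 1 := by
    have h1 : 1 < 1 / ρ := (one_lt_div hρ.1).2 hρ.2
    obtain ⟨r, hr, hr'⟩ := exists_between h1
    exact ⟨r, hr, by linarith, by rwa [lt_div_iff₀' hρ.1] at hr'⟩
  obtain ⟨M, hM0, hM⟩ := h.convPow_tail_le hr1
  have h1ρ : 0 < 1 - ρ := by linarith [hρ.2]
  set t : ℝ → ℕ → ℝ := fun u k => (1 - ρ) * ρ ^ k * ((convPow F (k + 2)).real (Ioi u) /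
    F.real (Ioi u) - if k + 2 ≤ n then (1 - (1 - F.real (Ioi u)) ^ (k + 2)) /
      F.real (Ioi u) else 0)
  have hsum : ∀ u, 0 ≤ u → HasSum (t u) (((pkLaw ρ F).real {x | u < pkSum x} -
      (pkLaw ρ F).real {x | u < pkTruncMax n x}) / F.real (Ioi u)) := by
    intro u hu
    refine (((hasSum_pkSum_tail hρ u).sub (hasSum_pkTruncMax_tail hρ n hu)).div_const
      _).congr_fun fun k => ?_
    simp only [t]
    split_ifs <;> ring
  have hF0 : Tendsto (fun u => F.real (Ioi u)) atTop (𝓝[≠] 0) :=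
    tendsto_nhdsWithin_iff.2 ⟨tendsto_measureReal_Ioi F,
      Eventually.of_forall fun u => (h.tail_pos u).ne'⟩
  rw [← (hasSum_geometric_tail_mean hρ hn).tsum_eq]
  have hlim : Tendsto (fun u => ∑' k, t u k) atTop (𝓝 (∑' k : ℕ, (1 - ρ) * ρ ^ k *
      if k + 2 ≤ n then 0 else ((k + 2 : ℕ) : ℝ))) := by
    refine tendsto_tsum_of_dominated_convergence
      (bound := fun k : ℕ => (1 - ρ) * (M * r ^ 2 * (ρ * r) ^ k) +
        (1 - ρ) * (k * ρ ^ k + 2 * ρ ^ k)) ?_ (fun k => ?_) ?_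
    · have hρr0 : 0 ≤ ρ * r := by have := hρ.1; positivity
      have hnorm : ‖ρ‖ < 1 := by rw [Real.norm_of_nonneg hρ.1.le]; exact hρ.2
      exact (((summable_geometric_of_lt_one hρr0 hρr).mul_left _).mul_left _).add
        (((hasSum_coe_mul_geometric_of_norm_lt_one hnorm).summable.add
          ((summable_geometric_of_norm_lt_one hnorm).mul_left 2)).mul_left _)
    · refine Tendsto.const_mul _ ?_
      split_ifs
      · have := (h.tendsto_convPow (k + 2)).sub ((tendsto_one_sub_pow_div (k + 2)).comp hF0)
        rwa [sub_self] at this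
      · simpa using h.tendsto_convPow (k + 2)
    · filter_upwards [eventually_ge_atTop 0] with u hu k
      have hFu := h.tail_pos u
      have hF1 : F.real (Ioi u) ≤ 1 := measureReal_le_one
      have b1 : (convPow F (k + 2)).real (Ioi u) / F.real (Ioi u) ≤ M * r ^ (k + 2) :=
        (div_le_iff₀ hFu).2 (hM _ u hu)
      have b1' : 0 ≤ (convPow F (k + 2)).real (Ioi u) / F.real (Ioi u) :=
        div_nonneg measureReal_nonneg hFu.le
      -- Bernoulli's inequality, i.e. the union bound for the maximum.
      have b2 : (1 - (1 - F.real (Ioi u)) ^ (k + 2)) / F.real (Ioi u) ≤ k + 2 := by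
        rw [div_le_iff₀ hFu]
        have := one_add_mul_le_pow (a := -F.real (Ioi u)) (by linarith) (k + 2)
        rw [← sub_eq_add_neg] at this
        push_cast at this
        linarith
      have b2' : 0 ≤ (1 - (1 - F.real (Ioi u)) ^ (k + 2)) / F.real (Ioi u) :=
        div_nonneg (sub_nonneg.2 (pow_le_one₀ (by linarith) (by linarith))) hFu.le
      have b3 : |(convPow F (k + 2)).real (Ioi u) / F.real (Ioi u) -
          if k + 2 ≤ n then (1 - (1 - F.real (Ioi u)) ^ (k + 2)) / F.real (Ioi u) else 0| ≤
          M * r ^ (k + 2) + (k + 2) := by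
        rw [abs_le]
        split_ifs <;> constructor <;> linarith
      have hc : 0 ≤ (1 - ρ) * ρ ^ k := mul_nonneg h1ρ.le (pow_nonneg hρ.1.le k)
      simp only [t]
      rw [Real.norm_eq_abs, abs_mul, abs_of_nonneg hc]
      refine (mul_le_mul_of_nonneg_left b3 hc).trans_eq ?_
      ring
  refine hlim.congr' ?_
  filter_upwards [eventually_ge_atTop 0] with u hu using (hsum u hu).tsum_eq

/-- The case `n = 1` of the difference, where `N + 2 ≥ 2` excludes every exceedance of the control.
-/
theorem IsSubexpTwoFold.tendsto_pkLaw_pkSum (h : IsSubexpTwoFold F)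
    (hρ : ρ ∈ Ioo (0 : ℝ) 1) :
    Tendsto (fun u => (pkLaw ρ F).real {x | u < pkSum x} / F.real (Ioi u)) atTop
      (𝓝 ((1 + (1 - ρ)) / (1 - ρ))) := by
  have h1 := h.tendsto_pkLaw_diff hρ le_rfl
  simp only [Nat.sub_self, pow_zero, one_mul, Nat.cast_one] at h1
  refine h1.congr' ?_
  filter_upwards [eventually_ge_atTop 0] with u hu
  have : {x : ℕ × (ℕ → ℝ) | u < pkTruncMax 1 x} = ∅ := by
    ext x
    simp [lt_pkTruncMax_iff hu]
  rw [this, measureReal_empty, sub_zero]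

theorem pkLaw_pkTruncMax_le (hF : F (Iio 0) = 0) {n : ℕ} {u : ℝ}
    (hu : 0 ≤ u) : (pkLaw ρ F).real {x | u < pkTruncMax n x} ≤
      (pkLaw ρ F).real {x | u < pkSum x} :=
  ENNReal.toReal_mono (measure_ne_top _ _) (measure_mono_ae (pkLaw_ae_lt_pkSum hF hu))

end PK

/-! ### Control variate estimators of two-valued variables -/

section Deterministic

variable {R : ℕ} {s : ℝ}

/-- There are only finitely many two-valued samples, so no lower bound on the denominator is needed.
-/
theorem exists_abs_empCoeff_le (R : ℕ) (s : ℝ) : ∃ C, 0 ≤ C ∧ ∀ z w : Fin R → ℝ,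
    (∀ i, z i = 0 ∨ z i = s) → (∀ i, w i = 0 ∨ w i = s) → |empCoeff z w| ≤ C := by
  set S : Set (Fin R → ℝ) := Set.pi univ fun _ => {0, s}
  have hS : S.Finite := Set.Finite.pi fun _ => Set.toFinite _
  obtain ⟨C, hC⟩ := ((hS.prod hS).image fun x => |empCoeff x.1 x.2|).bddAbove
  refine ⟨max C 0, le_max_right _ _, fun z w hz hw => (hC ⟨(z, w), ⟨?_, ?_⟩, rfl⟩).trans
    (le_max_left _ _)⟩
  · exact fun i _ => by simpa using hz i
  · exact fun i _ => by simpa using hw i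

theorem empMean_nonneg {z : Fin R → ℝ} (hz : ∀ i, 0 ≤ z i) : 0 ≤ empMean z :=
  div_nonneg (Finset.sum_nonneg fun i _ => hz i) R.cast_nonneg

theorem empMean_le (hR : 0 < R) {z : Fin R → ℝ} (hz : ∀ i, z i ≤ s) : empMean z ≤ s := by
  rw [empMean, div_le_iff₀ (by exact_mod_cast hR)]
  refine (Finset.sum_le_sum fun i _ => hz i).trans_eq ?_
  simp [mul_comm]

theorem controlVariateEstimator_zero (z : Fin R → ℝ) (m : ℝ) :
    controlVariateEstimator z (fun _ => 0) m = empMean z := by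
  simp [controlVariateEstimator, empCoeff, empMean]

/-- When control and target samples agree, the fitted coefficient is `-1` and all randomness
cancels. -/
theorem controlVariateEstimator_self {z : Fin R → ℝ} {m : ℝ}
    (hz : ∑ i, (z i - empMean z) ^ 2 ≠ 0) : controlVariateEstimator z z m = m := by
  have : empCoeff z z = -1 := by
    simp only [empCoeff, ← sq]
    rw [div_self hz]
  rw [controlVariateEstimator, this]
  ring

/-- If at most one of the variables `z i ∈ {0, s}` is non-zero and `w ≤ z`, then the square of
the control variate estimator is `(s / R) ^ 2` if `w` vanishes and `z` does not, and at most
`m ^ 2` otherwise; in general, the error is bounded by the products `z i * z j` with `i ≠ j`. -/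
theorem controlVariateEstimator_bounds (hR : 2 ≤ R) (hs : 0 < s) :
    ∃ C, 0 ≤ C ∧ ∀ (z w : Fin R → ℝ) (m : ℝ), (∀ i, z i = 0 ∨ z i = s) →
      (∀ i, w i = 0 ∨ w i = s) → (∀ i, w i ≤ z i) → 0 ≤ m → m ≤ s →
      |controlVariateEstimator z w m| ≤ C * ∑ i, z i ∧
      |controlVariateEstimator z w m ^ 2 - s / R ^ 2 * ∑ i, (z i - w i)| ≤
        m ^ 2 + C * ∑ x ∈ (Finset.univ : Finset (Fin R)).offDiag, z x.1 * z x.2 := by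
  obtain ⟨C₀, hC₀, hcoeff⟩ := exists_abs_empCoeff_le R s
  set B := s + C₀ * s
  have hB : 0 ≤ B := by positivity
  have hR0 : 0 < R := by omega
  have hRr : (1 : ℝ) ≤ R := by exact_mod_cast hR0
  -- `B` bounds the estimator always. One hit makes `∑ z i ≥ s`, so the first term of the constant
  -- gives the linear bound; two hits make the pair sum at least `s²`, so the second term covers
  -- both squares.
  refine ⟨B / s + (B ^ 2 + s ^ 2) / s ^ 2, by positivity, ?_⟩
  intro z w m hz hw hwz hm0 hms
  set C := B / s + (B ^ 2 + s ^ 2) / s ^ 2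
  have hC1 : B / s ≤ C := le_add_of_nonneg_right (by positivity)
  have hC2 : (B ^ 2 + s ^ 2) / s ^ 2 ≤ C := le_add_of_nonneg_left (by positivity)
  have hz0 : ∀ i, 0 ≤ z i := fun i => by rcases hz i with h | h <;> rw [h]; exact hs.le
  have hw0 : ∀ i, 0 ≤ w i := fun i => by rcases hw i with h | h <;> rw [h]; exact hs.le
  have hzs : ∀ i, z i ≤ s := fun i => by rcases hz i with h | h <;> rw [h]; exact hs.le
  have hws : ∀ i, w i ≤ s := fun i => (hwz i).trans (hzs i)
  have hest : |controlVariateEstimator z w m| ≤ B := by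
    refine (abs_add_le _ _).trans (add_le_add ?_ ?_)
    · rw [abs_of_nonneg (empMean_nonneg hz0)]
      exact empMean_le hR0 hzs
    · rw [abs_mul]
      refine mul_le_mul (hcoeff z w hz hw) ?_ (abs_nonneg _) hC₀
      have h1 := empMean_nonneg hw0
      have h2 := empMean_le hR0 hws
      rw [abs_le]
      constructor <;> linarith
  have hpair0 : ∀ x ∈ (Finset.univ : Finset (Fin R)).offDiag, 0 ≤ z x.1 * z x.2 :=
    fun x _ => mul_nonneg (hz0 _) (hz0 _)
  have hpair : 0 ≤ ∑ x ∈ (Finset.univ : Finset (Fin R)).offDiag, z x.1 * z x.2 :=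
    Finset.sum_nonneg hpair0
  have hCpair : 0 ≤ C * ∑ x ∈ (Finset.univ : Finset (Fin R)).offDiag, z x.1 * z x.2 := by
    positivity
  by_cases hall : ∀ i, z i = 0
  · obtain rfl : z = fun _ => 0 := funext hall
    obtain rfl : w = fun _ => 0 := funext fun i => le_antisymm (hwz i) (hw0 i)
    rw [controlVariateEstimator_zero]
    simp [empMean, sq_nonneg]
  push Not at hall
  obtain ⟨i₀, hi₀⟩ := hall
  have hi₀s : z i₀ = s := (hz i₀).resolve_left hi₀
  refine ⟨?_, ?_⟩
  · have h1 : s ≤ ∑ i, z i :=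
      hi₀s ▸ Finset.single_le_sum (fun i _ => hz0 i) (Finset.mem_univ i₀)
    calc |controlVariateEstimator z w m| ≤ B := hest
      _ = B / s * s := by field_simp
      _ ≤ C * ∑ i, z i := mul_le_mul hC1 h1 hs.le (by positivity)
  · by_cases hone : ∀ j, j ≠ i₀ → z j = 0
    · have hsum : ∀ f : Fin R → ℝ, (∀ j, j ≠ i₀ → f j = 0) → ∑ i, f i = f i₀ :=
        fun f hf => Finset.sum_eq_single i₀ (fun j _ hj => hf j hj) (by simp)
      have hw' : ∀ j, j ≠ i₀ → w j = 0 := fun j hj =>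
        le_antisymm ((hwz j).trans_eq (hone j hj)) (hw0 j)
      rw [hsum _ fun j hj => by rw [hone j hj, hw' j hj, sub_zero]]
      rcases hw i₀ with hwi | hwi
      · obtain rfl : w = fun _ => 0 := funext fun j => by
          by_cases hj : j = i₀
          · rw [hj, hwi]
          · exact hw' j hj
        rw [controlVariateEstimator_zero, empMean, hsum z hone, hi₀s]
        have : (s / R) ^ 2 - s / R ^ 2 * (s - 0) = 0 := by ring
        rw [this, abs_zero]
        positivity
      · obtain rfl : w = z := funext fun j => by
          by_cases hj : j = i₀
          · rw [hj, hwi, hi₀s]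
          · rw [hw' j hj, hone j hj]
        -- As `R ≥ 2`, some other entry is `0`, so the entries cannot all equal their mean.
        have hne : ∑ i, (w i - empMean w) ^ 2 ≠ 0 := by
          intro h0
          rw [Finset.sum_eq_zero_iff_of_nonneg fun _ _ => sq_nonneg _] at h0
          have : Nontrivial (Fin R) := Fin.nontrivial_iff_two_le.2 hR
          obtain ⟨j, hj⟩ := exists_ne i₀
          have h1 := pow_eq_zero_iff (two_ne_zero) |>.1 (h0 i₀ (Finset.mem_univ _))
          have h2 := pow_eq_zero_iff (two_ne_zero) |>.1 (h0 j (Finset.mem_univ _))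
          rw [hone j hj] at h2
          rw [hwi] at h1
          linarith
        rw [controlVariateEstimator_self hne]
        simpa using hCpair
    · push Not at hone
      obtain ⟨j, hj, hzj⟩ := hone
      have hzjs : z j = s := (hz j).resolve_left hzj
      have h1 : s ^ 2 ≤ ∑ x ∈ (Finset.univ : Finset (Fin R)).offDiag, z x.1 * z x.2 := by
        have hmem : (j, i₀) ∈ (Finset.univ : Finset (Fin R)).offDiag :=
          Finset.mem_offDiag.2 ⟨Finset.mem_univ j, Finset.mem_univ i₀, hj⟩
        have := Finset.single_le_sum hpair0 hmem
        simpa only [hzjs, hi₀s, ← sq] using this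
      have h2 : controlVariateEstimator z w m ^ 2 ≤ B ^ 2 := by
        rw [← sq_abs]
        exact pow_le_pow_left₀ (abs_nonneg _) hest 2
      have h3 : 0 ≤ ∑ i, (z i - w i) := Finset.sum_nonneg fun i _ => sub_nonneg.2 (hwz i)
      have h4 : ∑ i, (z i - w i) ≤ R * s := by
        refine (Finset.sum_le_sum (g := fun _ => s) fun i _ => ?_).trans_eq (by simp)
        linarith [hzs i, hw0 i]
      have h5 : s / R ^ 2 * ∑ i, (z i - w i) ≤ s ^ 2 := by
        calc s / R ^ 2 * ∑ i, (z i - w i) ≤ s / R ^ 2 * (R * s) :=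
              mul_le_mul_of_nonneg_left h4 (by positivity)
          _ = s ^ 2 / R := by field_simp
          _ ≤ s ^ 2 := div_le_self (by positivity) hRr
      have h6 : 0 ≤ s / R ^ 2 * ∑ i, (z i - w i) := by positivity
      have h7 : B ^ 2 + s ^ 2 ≤
          C * ∑ x ∈ (Finset.univ : Finset (Fin R)).offDiag, z x.1 * z x.2 := by
        calc B ^ 2 + s ^ 2 = (B ^ 2 + s ^ 2) / s ^ 2 * s ^ 2 := by field_simp
          _ ≤ _ := mul_le_mul hC2 h1 (by positivity) (by positivity)
      have h8 := sq_nonneg (controlVariateEstimator z w m)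
      have h9 := sq_nonneg m
      rw [abs_le]
      constructor <;> nlinarith

end Deterministic

/-! ### The variance of the estimators -/

section Variance

variable {F : Measure ℝ} {ρ : ℝ}

theorem pkCrude_eq_indicator (ρ u : ℝ) :
    pkCrude ρ u = {x | u < pkSum x}.indicator fun _ => ρ ^ 2 := by
  ext x
  simp [pkCrude, indicator_apply]

theorem pkControl_eq_indicator (ρ : ℝ) (n : ℕ) (u : ℝ) :
    pkControl ρ n u = {x | u < pkTruncMax n x}.indicator fun _ => ρ ^ 2 := by
  ext x
  simp [pkControl, indicator_apply]

theorem measurable_pkCrude (ρ u : ℝ) : Measurable (pkCrude ρ u) := by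
  rw [pkCrude_eq_indicator]
  exact measurable_const.indicator (measurableSet_lt_pkSum u)

theorem measurable_pkControl (ρ : ℝ) (n : ℕ) {u : ℝ} (hu : 0 ≤ u) :
    Measurable (pkControl ρ n u) := by
  rw [pkControl_eq_indicator]
  exact measurable_const.indicator (measurableSet_lt_pkTruncMax n hu)

theorem integral_pkCrude (u : ℝ) :
    ∫ x, pkCrude ρ u x ∂(pkLaw ρ F) = (pkLaw ρ F).real {x | u < pkSum x} * ρ ^ 2 := by
  rw [pkCrude_eq_indicator, integral_indicator_const _ (measurableSet_lt_pkSum u), smul_eq_mul]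

theorem integral_pkControl (n : ℕ) {u : ℝ} (hu : 0 ≤ u) :
    ∫ x, pkControl ρ n u x ∂(pkLaw ρ F) =
      (pkLaw ρ F).real {x | u < pkTruncMax n x} * ρ ^ 2 := by
  rw [pkControl_eq_indicator, integral_indicator_const _ (measurableSet_lt_pkTruncMax n hu),
    smul_eq_mul]

/-- For `n = 1` the control is identically zero, so crude Monte Carlo needs no separate analysis. -/
theorem pkControlEstimator_one {R : ℕ} {u : ℝ} (hu : 0 ≤ u)
    (x : Fin R → ℕ × (ℕ → ℝ)) :
    pkControlEstimator ρ F 1 u x = pkCrudeEstimator ρ u x := by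
  have : ∀ y, pkControl ρ 1 u y = 0 := fun y =>
    if_neg fun h => by simpa using ((lt_pkTruncMax_iff hu y).1 h).1
  simp only [pkControlEstimator, this, controlVariateEstimator_zero, pkCrudeEstimator]

variable [IsProbabilityMeasure F]

theorem abs_variance_pkControlEstimator_sub_le (hF : F (Iio 0) = 0) (hρ : ρ ∈ Ioo (0 : ℝ) 1)
    (n : ℕ) {R : ℕ} (hR : 2 ≤ R) {Ω : Type*} [MeasurableSpace Ω] (P : Measure Ω)
    [IsProbabilityMeasure P] (X : Fin R → Ω → ℕ × (ℕ → ℝ))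
    (hX_law : ∀ i, HasLaw (X i) (pkLaw ρ F) P) (hX_indep : iIndepFun X P) :
    ∃ K, ∀ u, 0 ≤ u →
      |variance (fun ω => pkControlEstimator ρ F n u fun i => X i ω) P -
        ρ ^ 4 / R * ((pkLaw ρ F).real {x | u < pkSum x} -
          (pkLaw ρ F).real {x | u < pkTruncMax n x})| ≤
        K * (pkLaw ρ F).real {x | u < pkSum x} ^ 2 := by
  set s := ρ ^ 2
  have hs : 0 < s := pow_pos hρ.1 2
  have hR0 : (0 : ℝ) < R := by exact_mod_cast (by omega : 0 < R)
  obtain ⟨C, hC, hbound⟩ := controlVariateEstimator_bounds hR hs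
  set D : Finset (Fin R × Fin R) := Finset.univ.offDiag
  -- The three terms bound, in units of `p²`, the squared control mean `(q s)²`, the pairs of hits
  -- (each of expectation `(p s)²` by independence), and the squared mean of the estimator.
  refine ⟨s ^ 2 + C * (D.card * s ^ 2) + (C * (R * s)) ^ 2, fun u hu => ?_⟩
  set p := (pkLaw ρ F).real {x | u < pkSum x}
  set q := (pkLaw ρ F).real {x | u < pkTruncMax n x}
  have hp0 : 0 ≤ p := measureReal_nonneg
  have hq0 : 0 ≤ q := measureReal_nonneg
  have hqp : q ≤ p := pkLaw_pkTruncMax_le hF hu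
  have hq1 : q ≤ 1 := measureReal_le_one
  set z : Fin R → Ω → ℝ := fun i ω => pkCrude ρ u (X i ω)
  set w : Fin R → Ω → ℝ := fun i ω => pkControl ρ n u (X i ω)
  set G : Ω → ℝ := fun ω => pkControlEstimator ρ F n u fun i => X i ω
  have hGdef : ∀ ω, G ω =
      controlVariateEstimator (fun i => z i ω) (fun i => w i ω) (q * s) := by
    intro ω
    simp only [G, pkControlEstimator, integral_pkControl n hu]
    rfl
  have hzv : ∀ i ω, z i ω = 0 ∨ z i ω = s := fun i ω => by
    simp only [z, pkCrude]; split_ifs <;> simp [s]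
  have hwv : ∀ i ω, w i ω = 0 ∨ w i ω = s := fun i ω => by
    simp only [w, pkControl]; split_ifs <;> simp [s]
  have hzs : ∀ i ω, |z i ω| ≤ s := fun i ω => by
    rcases hzv i ω with h | h <;> rw [h]
    · simpa using hs.le
    · exact (abs_of_pos hs).le
  have hws : ∀ i ω, |w i ω| ≤ s := fun i ω => by
    rcases hwv i ω with h | h <;> rw [h]
    · simpa using hs.le
    · exact (abs_of_pos hs).le
  have hzm : ∀ i, AEMeasurable (z i) P := fun i =>
    (measurable_pkCrude ρ u).comp_aemeasurable (hX_law i).aemeasurable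
  have hwm : ∀ i, AEMeasurable (w i) P := fun i =>
    (measurable_pkControl ρ n hu).comp_aemeasurable (hX_law i).aemeasurable
  have hzi : ∀ i, Integrable (z i) P := fun i =>
    Integrable.of_bound (hzm i).aestronglyMeasurable s (Eventually.of_forall (hzs i))
  have hwi : ∀ i, Integrable (w i) P := fun i =>
    Integrable.of_bound (hwm i).aestronglyMeasurable s (Eventually.of_forall (hws i))
  have hEz : ∀ i, ∫ ω, z i ω ∂P = p * s := fun i =>
    ((hX_law i).integral_comp (measurable_pkCrude ρ u).aestronglyMeasurable).trans
      (integral_pkCrude u)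
  have hEw : ∀ i, ∫ ω, w i ω ∂P = q * s := fun i =>
    ((hX_law i).integral_comp (measurable_pkControl ρ n hu).aestronglyMeasurable).trans
      (integral_pkControl n hu)
  have hle : ∀ᵐ ω ∂P, ∀ i, w i ω ≤ z i ω := by
    refine ae_all_iff.2 fun i => ?_
    have h1 := pkLaw_ae_lt_pkSum (ρ := ρ) hF (n := n) hu
    rw [← (hX_law i).map_eq] at h1
    filter_upwards [ae_of_ae_map (hX_law i).aemeasurable h1] with ω hω
    simp only [w, z, pkControl, pkCrude]
    split_ifs with h2 h3 h3
    · exact le_rfl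
    · exact absurd (hω h2) h3
    · exact hs.le
    · exact le_rfl
  have hGm : AEMeasurable G P := by
    have : G = fun ω => controlVariateEstimator (fun i => z i ω) (fun i => w i ω) (q * s) :=
      funext hGdef
    rw [this]
    simp only [controlVariateEstimator, empCoeff, empMean]
    fun_prop
  have hGb : ∀ᵐ ω ∂P, |G ω| ≤ C * ∑ i, z i ω ∧
      |G ω ^ 2 - s / R ^ 2 * ∑ i, (z i ω - w i ω)| ≤
        (q * s) ^ 2 + C * ∑ x ∈ D, z x.1 ω * z x.2 ω := by
    filter_upwards [hle] with ω hω
    rw [hGdef]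
    exact hbound _ _ _ (fun i => hzv i ω) (fun i => hwv i ω) hω (by positivity)
      (mul_le_of_le_one_left hs.le hq1)
  have hGbound : ∀ᵐ ω ∂P, ‖G ω‖ ≤ C * (R * s) := by
    filter_upwards [hGb] with ω hω
    refine hω.1.trans (mul_le_mul_of_nonneg_left ?_ hC)
    refine (Finset.sum_le_sum fun i _ => (le_abs_self _).trans (hzs i ω)).trans_eq ?_
    simp
  have hGL : MemLp G 2 P := MemLp.of_bound hGm.aestronglyMeasurable _ hGbound
  have hG2 : Integrable (fun ω => G ω ^ 2) P := hGL.integrable_sq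
  have hzz : ∀ x : Fin R × Fin R, Integrable (fun ω => z x.1 ω * z x.2 ω) P := fun x =>
    (hzi x.2).bdd_mul (hzm x.1).aestronglyMeasurable (Eventually.of_forall (hzs x.1))
  have hEzz : ∀ x ∈ D, ∫ ω, z x.1 ω * z x.2 ω ∂P = (p * s) ^ 2 := by
    intro x hx
    have hind := (hX_indep.indepFun (Finset.mem_offDiag.1 hx).2.2).comp
      (measurable_pkCrude ρ u) (measurable_pkCrude ρ u)
    have := hind.integral_fun_mul_eq_mul_integral (hzm x.1).aestronglyMeasurable
      (hzm x.2).aestronglyMeasurable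
    refine this.trans ?_
    rw [sq]
    exact congrArg₂ _ (hEz x.1) (hEz x.2)
  have hmean : |∫ ω, G ω ∂P| ≤ C * (R * s) * p := by
    calc |∫ ω, G ω ∂P| ≤ ∫ ω, |G ω| ∂P := abs_integral_le_integral_abs
      _ ≤ ∫ ω, C * ∑ i, z i ω ∂P :=
          integral_mono_ae (hGL.integrable one_le_two).abs
            ((integrable_finsetSum _ fun i _ => hzi i).const_mul C)
            (hGb.mono fun ω h => h.1)
      _ = C * (R * s) * p := by
          rw [integral_const_mul, integral_finsetSum _ fun i _ => hzi i]
          simp only [hEz, Finset.sum_const, Finset.card_univ, Fintype.card_fin, nsmul_eq_mul]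
          ring
  have hsq : |∫ ω, G ω ^ 2 ∂P - s ^ 2 / R * (p - q)| ≤
      (q * s) ^ 2 + C * (D.card * (p * s) ^ 2) := by
    have hd : ∀ i, Integrable (fun ω => z i ω - w i ω) P := fun i => (hzi i).sub (hwi i)
    have hlin : Integrable (fun ω => s / R ^ 2 * ∑ i, (z i ω - w i ω)) P :=
      (integrable_finsetSum _ fun i _ => hd i).const_mul _
    have e1 : ∫ ω, s / R ^ 2 * ∑ i, (z i ω - w i ω) ∂P = s ^ 2 / R * (p - q) := by
      rw [integral_const_mul, integral_finsetSum _ fun i _ => hd i]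
      simp only [integral_sub (hzi _) (hwi _), hEz, hEw, Finset.sum_const, Finset.card_univ,
        Fintype.card_fin, nsmul_eq_mul]
      field_simp
    rw [← e1, ← integral_sub hG2 hlin]
    refine abs_integral_le_integral_abs.trans ?_
    calc ∫ ω, |G ω ^ 2 - s / R ^ 2 * ∑ i, (z i ω - w i ω)| ∂P
        ≤ ∫ ω, ((q * s) ^ 2 + C * ∑ x ∈ D, z x.1 ω * z x.2 ω) ∂P :=
          integral_mono_ae (hG2.sub hlin).abs ((integrable_const _).add
            ((integrable_finsetSum _ fun x _ => hzz x).const_mul C))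
            (hGb.mono fun ω h => h.2)
      _ = _ := by
          rw [integral_add (integrable_const _)
            ((integrable_finsetSum _ fun x _ => hzz x).const_mul C), integral_const_mul,
            integral_finsetSum _ fun x _ => hzz x, Finset.sum_congr rfl hEzz]
          simp
  have hvar : variance G P = ∫ ω, G ω ^ 2 ∂P - (∫ ω, G ω ∂P) ^ 2 := variance_eq_sub hGL
  have h1 : (∫ ω, G ω ∂P) ^ 2 ≤ (C * (R * s) * p) ^ 2 := by
    rw [← sq_abs]
    exact pow_le_pow_left₀ (abs_nonneg _) hmean 2
  have h2 : (q * s) ^ 2 ≤ (p * s) ^ 2 := by gcongr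
  have h3 := sq_nonneg (∫ ω, G ω ∂P)
  have h4 : ρ ^ 4 = s ^ 2 := by simp only [s]; ring
  have h5 := abs_le.1 hsq
  rw [hvar, h4, abs_le]
  constructor <;> nlinarith

/-- Since `p = O(F̄(u))`, the error `K p²` is `o(F̄(u))` and only the limit of `(p - q) / F̄(u)`
remains. -/
theorem IsSubexpTwoFold.tendsto_variance_pkControlEstimator (h : IsSubexpTwoFold F)
    (hρ : ρ ∈ Ioo (0 : ℝ) 1) {n : ℕ} (hn : 1 ≤ n) {R : ℕ} (hR : 2 ≤ R) {Ω : Type*}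
    [MeasurableSpace Ω] (P : Measure Ω) [IsProbabilityMeasure P]
    (X : Fin R → Ω → ℕ × (ℕ → ℝ)) (hX_law : ∀ i, HasLaw (X i) (pkLaw ρ F) P)
    (hX_indep : iIndepFun X P) :
    Tendsto (fun u => variance (fun ω => pkControlEstimator ρ F n u fun i => X i ω) P /
        F.real (Ioi u)) atTop
      (𝓝 (ρ ^ 4 / R * (ρ ^ (n - 1) * ((1 + n * (1 - ρ)) / (1 - ρ))))) := by
  obtain ⟨K, hK⟩ := abs_variance_pkControlEstimator_sub_le h.nonneg hρ n hR P X hX_law hX_indep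
  have hp := h.tendsto_pkLaw_pkSum hρ
  have hp2 : Tendsto (fun u => K * (pkLaw ρ F).real {x | u < pkSum x} ^ 2 / F.real (Ioi u))
      atTop (𝓝 0) := by
    have h1 := ((hp.mul hp).mul (tendsto_measureReal_Ioi F)).const_mul K
    rw [mul_zero, mul_zero] at h1
    refine h1.congr fun u => ?_
    have := (h.tail_pos u).ne'
    field_simp
  have herr : Tendsto (fun u => (variance (fun ω => pkControlEstimator ρ F n u fun i => X i ω) P -
        ρ ^ 4 / R * ((pkLaw ρ F).real {x | u < pkSum x} -
          (pkLaw ρ F).real {x | u < pkTruncMax n x})) / F.real (Ioi u)) atTop (𝓝 0) := by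
    refine squeeze_zero_norm' ?_ hp2
    filter_upwards [eventually_ge_atTop 0] with u hu
    rw [norm_div, Real.norm_of_nonneg (h.tail_pos u).le]
    exact div_le_div_of_nonneg_right (hK u hu) (h.tail_pos u).le
  have hmain := herr.add ((h.tendsto_pkLaw_diff hρ hn).const_mul (ρ ^ 4 / R))
  rw [zero_add] at hmain
  refine hmain.congr fun u => ?_
  ring

end Variance

theorem mainTheorem2
    -- the arrival rate, the probability of a heavy-tailed claim, the two claim size laws
    (arrival ε : ℝ) (light heavy : Measure ℝ) [IsProbabilityMeasure heavy]
    (h_arrival : 0 < arrival) (hε : ε ∈ Ioo (0 : ℝ) 1)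
    (h_light : IsPhaseType light) (h_light_mean : Integrable (fun x : ℝ => x) light)
    (h_heavy_nonneg : heavy (Iio 0) = 0) (h_heavy_mean : Integrable (fun x : ℝ => x) heavy)
    (h_heavy_subexp : IsSubexponential (excessLaw heavy))
    -- the heavy-tailed claim rate and the overall claim rate, with the safety loading condition
    (γh ρ : ℝ) (hγh : γh = arrival * lawMean heavy)
    (hρ : ρ = arrival * lawMean (mixtureLaw ε light heavy)) (hρ_lt : ρ < 1)
    -- the order of the approximation and the number of simulations
    (n R : ℕ) (hn : 1 ≤ n) (hR : 2 ≤ R)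
    -- the `R` simulated independent copies
    {Ω : Type*} [MeasurableSpace Ω] (P : Measure Ω) [IsProbabilityMeasure P]
    (X : Fin R → Ω → ℕ × (ℕ → ℝ))
    (hX_law : ∀ i, HasLaw (X i) (pkLaw ρ (excessLaw (mixtureLaw ε light heavy))) P)
    (hX_indep : iIndepFun X P) :
    ((fun u : ℝ => variance (fun ω => pkControlEstimator ρ
          (excessLaw (mixtureLaw ε light heavy)) n u (fun i => X i ω)) P)
      ~[atTop] fun u : ℝ => ρ ^ (n + 3) * ((1 + n * (1 - ρ)) / (1 - ρ)) * (ε * γh / ρ) *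
          ((excessLaw heavy).real (Ioi u) / R)) ∧
    Tendsto (fun u : ℝ =>
        variance (fun ω => pkControlEstimator ρ
          (excessLaw (mixtureLaw ε light heavy)) n u (fun i => X i ω)) P /
        variance (fun ω => pkCrudeEstimator ρ u (fun i => X i ω)) P)
      atTop (𝓝 (ρ ^ (n - 1) * ((1 + n * (1 - ρ)) / (1 + (1 - ρ))))) := by
  have hlight := h_light.isProbabilityMeasure
  have hl0 := h_light.nonneg
  obtain ⟨C, δ, -, hδ, htail⟩ := h_light.exp_tail
  have hH := h_heavy_subexp.isSubexpTwoFold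
  have hmh := lawMean_pos_of_excessLaw h_heavy_nonneg hH.isProbabilityMeasure
  have hmB : 0 < lawMean (mixtureLaw ε light heavy) := by
    rw [lawMean_mixtureLaw hε h_light_mean h_heavy_mean]
    exact add_pos_of_nonneg_of_pos
      (mul_nonneg (by linarith [hε.2]) (lawMean_nonneg hl0)) (mul_pos hε.1 hmh)
  have hρ01 : ρ ∈ Ioo (0 : ℝ) 1 := ⟨hρ ▸ mul_pos h_arrival hmB, hρ_lt⟩
  have hc : 0 < ε * γh / ρ := by
    rw [hγh]
    exact div_pos (mul_pos hε.1 (mul_pos h_arrival hmh)) hρ01.1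
  have hB := mixtureLaw_isProbabilityMeasure (light := light) (heavy := heavy) hε
  have hB0 := mixtureLaw_Iio (ε := ε) hl0 h_heavy_nonneg
  have hF := excessLaw_isProbabilityMeasure hB0
    (mixtureLaw_integrable h_light_mean h_heavy_mean) hmB
  have hFH := tendsto_excessLaw_mixtureLaw hε hl0 h_heavy_nonneg h_light_mean h_heavy_mean hδ
    htail hH
  have hcoef : ε * lawMean heavy / lawMean (mixtureLaw ε light heavy) = ε * γh / ρ := by
    rw [hγh, hρ]
    field_simp
  rw [hcoef] at hFH
  have hFsub := hH.of_tail_equiv (excessLaw_Iio _) hc hFH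
  have h1ρ : 0 < 1 - ρ := by linarith
  have hR0 : (0 : ℝ) < R := by exact_mod_cast (by omega : 0 < R)
  have hρ0 := hρ01.1
  have hvar := hFsub.tendsto_variance_pkControlEstimator hρ01 hn hR P X hX_law hX_indep
  -- The crude variance is taken as the case `n = 1`; its limit is positive, so the ratio of limits
  -- is legitimate.
  have hcrude := hFsub.tendsto_variance_pkControlEstimator hρ01 le_rfl hR P X hX_law hX_indep
  obtain ⟨m, rfl⟩ := Nat.exists_eq_add_of_le' hn
  rw [Nat.add_sub_cancel] at hvar ⊢
  constructor
  · rw [isEquivalent_iff_tendsto_one (Eventually.of_forall fun u => by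
      have := hH.tail_pos u
      positivity)]
    have h1 := (hvar.mul hFH).mul_const ((ρ ^ (m + 1 + 3) * ((1 + ((m + 1 : ℕ) : ℝ) *
      (1 - ρ)) / (1 - ρ)) * (ε * γh / ρ) * (1 / R))⁻¹)
    convert! h1.congr fun u => ?_ using 1
    · congr 1
      rw [eq_comm, mul_inv_eq_one₀ (by positivity)]
      ring
    · have e1 := (hFsub.tail_pos u).ne'
      have e2 := (hH.tail_pos u).ne'
      simp only [Pi.div_apply]
      rw [div_mul_div_cancel₀ e1, ← div_eq_mul_inv, div_div]
      congr 1
      ring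
  · have h1 := hvar.div hcrude (by positivity)
    convert! h1.congr' ?_ using 1
    · congr 1
      simp only [Nat.sub_self, pow_zero, Nat.cast_one, one_mul]
      have : 1 + (1 - ρ) ≠ 0 := by positivity
      field_simp
    · filter_upwards [eventually_ge_atTop 0] with u hu
      simp only [Pi.div_apply, pkControlEstimator_one hu]
      exact div_div_div_cancel_right₀ (hFsub.tail_pos u).ne' _ _
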